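/- For $n\ge 1$ let $P_n$ denote the path graph on $n$ vertices. For graphs $F$, $G$, $H$ write $G\rightarrow(F,H)$ if every coloring of the edges of $G$ with the two colors red and blue contains a red (not necessarily induced) copy of $F$ or a blue (not necessarily induced) copy of $H$. The decision problem $(P_3,P_4)$-Arrowing asks, given a finite simple undirected graph $G$, whether $G\rightarrow(P_3,P_4)$. **Theorem.** $(P_3,P_4)$-Arrowing is in $\mathrm{P}$. That is, with a graph $G$ on $\{0,\dots,n-1\}$ encoded as the binary word $1^n0$ followed by the $n^2$ entries of its adjacency matrix, row by row, the language of all encodings of finite graphs $G$ with $G\rightarrow(P_3,P_4)$ is decided by a deterministic Turing machine that halts on every binary word $w$ after a number of steps bounded by a polynomial in the length of $w$. -/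

import Mathlib

namespace PathArrowing

/-- The two colors of an edge coloring. -/
inductive EdgeColor
  | red
  | blue

/-- `c` is an `(F, H)`-good coloring of the edges of `G`: the red subgraph contains no copy of `F`
and the blue subgraph contains no copy of `H` (copies need not be induced). -/
def IsGoodColoring {U V W : Type} (F : SimpleGraph U) (H : SimpleGraph W) (G : SimpleGraph V)
    (c : G.EdgeLabeling EdgeColor) : Prop :=
  F.Free (c.labelGraph EdgeColor.red) ∧ H.Free (c.labelGraph EdgeColor.blue)

/-- `G → (F, H)`: every red/blue coloring of the edges of `G` contains a red copy of `F` or a blue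
copy of `H`. -/
def Arrows {U V W : Type} (G : SimpleGraph V) (F : SimpleGraph U) (H : SimpleGraph W) : Prop :=
  ∀ c : G.EdgeLabeling EdgeColor,
    F.IsContained (c.labelGraph EdgeColor.red) ∨ H.IsContained (c.labelGraph EdgeColor.blue)

/-- A graph arrows `(F, H)` iff it has no `(F, H)`-good coloring. -/
theorem arrows_iff_not_exists_isGoodColoring {U V W : Type} (G : SimpleGraph V)
    (F : SimpleGraph U) (H : SimpleGraph W) :
    Arrows G F H ↔ ¬ ∃ c : G.EdgeLabeling EdgeColor, IsGoodColoring F H G c := by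
  simp only [Arrows, IsGoodColoring, SimpleGraph.Free, not_exists, not_and_or, not_not]

open scoped Classical in
/-- The binary word that encodes a finite graph on the vertex set `{0, …, n - 1}`: the number `n`
of vertices in unary, the delimiter `0`, and the `n × n` adjacency matrix, row by row. -/
noncomputable def encodeGraph {n : ℕ} (G : SimpleGraph (Fin n)) : List Bool :=
  List.replicate n true ++ false ::
    (List.finRange n).flatMap fun i => (List.finRange n).map fun j => decide (G.Adj i j)

/-- The `(F, H)`-Arrowing problem, as the language of all encodings of finite graphs `G` with
`G → (F, H)`. -/
def arrowingLanguage {U W : Type} (F : SimpleGraph U) (H : SimpleGraph W) : Language Bool :=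
  {w | ∃ (n : ℕ) (G : SimpleGraph (Fin n)), encodeGraph G = w ∧ Arrows G F H}

/-- The complexity class P: the languages over `{0, 1}` that are decided by a deterministic
multi-stack Turing machine which, on every input word, halts after a number of steps bounded by a
polynomial in the length of the word, with the correct one-bit answer on its output stack. -/
def InP (L : Language Bool) : Prop :=
  ∃ f : List Bool → Bool, (∀ w, f w = true ↔ w ∈ L) ∧
    Nonempty (Turing.TM2ComputableInPolyTime (id : List Bool → List Bool)
      Computability.encodeBool f)

end PathArrowing

/-!
A graph `G` fails to arrow `(P₃, P₄)` iff it has a matching, the red edges, that meets each path on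
four vertices. Taken literally, this is a 3-CNF in the edges. It can be replaced by a 2-CNF
(`IsRedGraph`), whose constraints concern triangles with an edge leaving them and the branching at
the end of a path on three vertices. They are necessary, and they suffice because a red graph may be
taken maximal among those that satisfy them: if a path `a b c d` had no red edge, the constraints
would leave no edges at `b` and `c` other than those of the path, and so `bc` could be added
(`IsRedGraph.exists_adj_of_maximal`). This gives `not_arrows_iff_exists_isRedGraph`.

A 2-CNF is unsatisfiable iff some variable and its negation imply each other in the implication
graph (`not_satisfiable_iff`). With pairs of vertices as variables, this is a question of
reachability among `2 n²` literals, which is settled by `2 n²` rounds of marking what the marked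
literals imply directly.

Polynomial time refers to multi-stack Turing machines, and the machine is obtained by two
compilations. Structured programs over stacks (`Code`) are turned into machines whose labels are the
positions in the program (`Code.toFinTM2`, `inP_of_runs`). Programs over two-dimensional arrays of
bits, with nested loops over vertices (`Prog`), are turned into `Code`, each array being a tape made
of two stacks (`runs_code`, which also bounds the number of steps). Together with the parsing of the
input this yields `inP_of_prog`. The array program that decides unsatisfiability is `unsatProg`, and
`denote_unsatProg` is its correctness.
-/

/-! ### Good colorings and a 2-CNF for them -/

namespace PathArrowing

open SimpleGraph

theorem pathGraph_three_isContained_iff {V : Type} (H : SimpleGraph V) :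
    (pathGraph 3).IsContained H ↔ ∃ a b c, H.Adj a b ∧ H.Adj b c ∧ a ≠ c := by
  constructor
  · rintro ⟨f⟩
    refine ⟨f 0, f 1, f 2, f.toHom.map_adj ?_, f.toHom.map_adj ?_, f.injective.ne (by decide)⟩ <;>
      simp [pathGraph_adj]
  · rintro ⟨a, b, c, hab, hbc, hac⟩
    refine ⟨⟨⟨![a, b, c], ?_⟩, ?_⟩⟩
    · intro i j hij
      rw [pathGraph_adj] at hij
      fin_cases i <;> fin_cases j <;> simp_all [H.adj_comm]
    · have := hab.ne; have := hbc.ne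
      intro i j hij
      fin_cases i <;> fin_cases j <;> simp_all

theorem pathGraph_four_isContained_iff {V : Type} (H : SimpleGraph V) :
    (pathGraph 4).IsContained H ↔
      ∃ a b c d, H.Adj a b ∧ H.Adj b c ∧ H.Adj c d ∧ a ≠ c ∧ a ≠ d ∧ b ≠ d := by
  constructor
  · rintro ⟨f⟩
    refine ⟨f 0, f 1, f 2, f 3, f.toHom.map_adj ?_, f.toHom.map_adj ?_, f.toHom.map_adj ?_,
      f.injective.ne (by decide), f.injective.ne (by decide), f.injective.ne (by decide)⟩ <;>
      simp [pathGraph_adj]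
  · rintro ⟨a, b, c, d, hab, hbc, hcd, hac, had, hbd⟩
    refine ⟨⟨⟨![a, b, c, d], ?_⟩, ?_⟩⟩
    · intro i j hij
      rw [pathGraph_adj] at hij
      fin_cases i <;> fin_cases j <;> simp_all [H.adj_comm]
    · have := hab.ne; have := hbc.ne; have := hcd.ne
      intro i j hij
      fin_cases i <;> fin_cases j <;> simp_all

/-- The 2-CNF constraints on the graph `R` of red edges of `G`. They are necessary for a good
coloring. In a triangle `a b c` with an edge `cd` leaving it, a red `ac` would make the path
`a b c d` blue (`chord`); the same holds for `bc`, so `ab` or `cd` has to be red (`pendant`). If `c`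
has two further neighbors `d` and `e`, only one of `cd` and `ce` can be red, so the paths `a b c d`
and `a b c e` need a red edge among `ab` and `bc` (`branch`). -/
structure IsRedGraph {V : Type} (G R : SimpleGraph V) : Prop where
  le : R ≤ G
  matching : ∀ a b c, R.Adj a b → R.Adj a c → b = c
  chord : ∀ a b c d, G.Adj a b → G.Adj b c → G.Adj a c → G.Adj c d → d ≠ a → d ≠ b → ¬ R.Adj a c
  pendant : ∀ a b c d, G.Adj a b → G.Adj b c → G.Adj a c → G.Adj c d → d ≠ a → d ≠ b →
    R.Adj a b ∨ R.Adj c d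
  branch : ∀ a b c d e, G.Adj a b → G.Adj b c → a ≠ c → ¬ G.Adj a c → G.Adj c d → G.Adj c e →
    d ≠ b → e ≠ b → d ≠ e → R.Adj a b ∨ R.Adj b c

/-- The red graph of a good coloring satisfies the constraints. -/
theorem IsGoodColoring.isRedGraph {V : Type} {G : SimpleGraph V} {c : G.EdgeLabeling EdgeColor}
    (hc : IsGoodColoring (pathGraph 3) (pathGraph 4) G c) :
    IsRedGraph G (c.labelGraph EdgeColor.red) := by
  obtain ⟨h3, h4⟩ := hc
  rw [SimpleGraph.Free, pathGraph_three_isContained_iff] at h3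
  rw [SimpleGraph.Free, pathGraph_four_isContained_iff] at h4
  have hm : ∀ a b d, (c.labelGraph EdgeColor.red).Adj a b → (c.labelGraph EdgeColor.red).Adj a d →
      b = d := fun a b d hab had => by
    by_contra hne
    exact h3 ⟨b, a, d, hab.symm, had, hne⟩
  have hb : ∀ a b, G.Adj a b → ¬ (c.labelGraph EdgeColor.red).Adj a b →
      (c.labelGraph EdgeColor.blue).Adj a b := fun a b hab hr => by
    rw [EdgeLabeling.labelGraph_adj] at hr ⊢
    refine ⟨hab, ?_⟩
    cases h : c ⟨s(a, b), hab⟩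
    · exact absurd ⟨hab, h⟩ hr
    · rfl
  have hp : ∀ x y z w, G.Adj x y → G.Adj y z → G.Adj z w → x ≠ z → x ≠ w → y ≠ w →
      (c.labelGraph EdgeColor.red).Adj x y ∨ (c.labelGraph EdgeColor.red).Adj y z ∨
        (c.labelGraph EdgeColor.red).Adj z w := fun x y z w hxy hyz hzw h1 h2 h3 => by
    by_contra! h
    exact h4 ⟨x, y, z, w, hb _ _ hxy h.1, hb _ _ hyz h.2.1, hb _ _ hzw h.2.2, h1, h2, h3⟩
  have hle := c.labelGraph_le (k := EdgeColor.red)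
  generalize c.labelGraph EdgeColor.red = R at *
  have hch : ∀ a b c d, G.Adj a b → G.Adj b c → G.Adj a c → G.Adj c d → d ≠ a → d ≠ b →
      ¬ R.Adj a c := fun x y z w hxy hyz hxz hzw h1 h2 hr => by
    rcases hp x y z w hxy hyz hzw hxz.ne h1.symm h2.symm with h | h | h
    · exact hyz.ne (hm _ _ _ h hr)
    · exact hxy.ne (hm _ _ _ hr.symm h.symm)
    · exact h1 (hm _ _ _ h hr.symm)
  refine ⟨hle, hm, hch, ?_, ?_⟩
  · intro x y z w hxy hyz hxz hzw h1 h2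
    rcases hp x y z w hxy hyz hzw hxz.ne h1.symm h2.symm with h | h | h
    · exact Or.inl h
    · exact absurd h (hch y x z w hxy.symm hxz hyz hzw h2 h1)
    · exact Or.inr h
  · intro x y z w u hxy hyz hxz hnxz hzw hzu h1 h2 h3
    by_contra! hn
    have hxw : x ≠ w := by rintro rfl; exact hnxz hzw.symm
    have hxu : x ≠ u := by rintro rfl; exact hnxz hzu.symm
    have hw := hp x y z w hxy hyz hzw hxz hxw h1.symm
    have hu := hp x y z u hxy hyz hzu hxz hxu h2.symm
    exact h3 (hm z w u (by tauto) (by tauto))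

/-- A red graph that is maximal among those satisfying the constraints meets every path on four
vertices: the middle edge of a path `a b c d` without red edges could be recolored red. -/
theorem IsRedGraph.exists_adj_of_maximal {V : Type} {G R : SimpleGraph V}
    (hR : Maximal (IsRedGraph G) R) {a b c d : V} (hab : G.Adj a b) (hbc : G.Adj b c)
    (hcd : G.Adj c d) (hac : a ≠ c) (had : a ≠ d) (hbd : b ≠ d) :
    R.Adj a b ∨ R.Adj b c ∨ R.Adj c d := by
  by_contra! hn
  obtain ⟨nab, nbc, ncd⟩ := hn
  have h := hR.prop
  -- the constraints on `a b c d` leave no edges at `b` and `c` other than those of the path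
  have gac : ¬ G.Adj a c := fun hG => by
    have := h.pendant a b c d hab hbc hG hcd had.symm hbd.symm
    tauto
  have gbd : ¬ G.Adj d b := fun hG => by
    have := h.pendant d c b a hcd.symm hbc.symm hG hab.symm had hac
    rw [R.adj_comm d c, R.adj_comm b a] at this
    tauto
  have hNc : ∀ e, G.Adj c e → e = b ∨ e = d := fun e he => by
    by_contra! hne
    have := h.branch a b c d e hab hbc hac gac hcd he hbd.symm hne.1 hne.2.symm
    tauto
  have hNb : ∀ e, G.Adj b e → e = c ∨ e = a := fun e he => by
    by_contra! hne
    have := h.branch d c b a e hcd.symm hbc.symm hbd.symm gbd hab.symm he hac hne.1 hne.2.symm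
    rw [R.adj_comm d c, R.adj_comm c b] at this
    tauto
  have hRb : ∀ e, ¬ R.Adj b e := fun e he => by
    rcases hNb e (h.le he) with rfl | rfl
    · exact nbc he
    · exact nab he.symm
  have hRc : ∀ e, ¬ R.Adj c e := fun e he => by
    rcases hNc e (h.le he) with rfl | rfl
    · exact nbc he.symm
    · exact ncd he
  have hnew : IsRedGraph G (R ⊔ edge b c) := by
    have hadj : ∀ x y, (R ⊔ edge b c).Adj x y ↔ R.Adj x y ∨ x = b ∧ y = c ∨ x = c ∧ y = b := by
      intro x y
      rw [sup_adj, edge_adj]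
      have := hbc.ne
      grind
    refine ⟨?_, ?_, ?_, ?_, ?_⟩
    · intro x y hxy
      rcases (hadj x y).1 hxy with h1 | ⟨rfl, rfl⟩ | ⟨rfl, rfl⟩
      exacts [h.le h1, hbc, hbc.symm]
    · intro x y z hxy hxz
      rw [hadj] at hxy hxz
      rcases hxy with h1 | ⟨rfl, rfl⟩ | ⟨rfl, rfl⟩ <;> rcases hxz with h2 | ⟨h2, rfl⟩ | ⟨h2, rfl⟩
      · exact h.matching _ _ _ h1 h2
      · subst h2; exact absurd h1 (hRb _)
      · subst h2; exact absurd h1 (hRc _)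
      · exact absurd h2 (hRb _)
      · rfl
      · exact absurd h2 hbc.ne
      · exact absurd h2 (hRc _)
      · exact absurd h2.symm hbc.ne
      · rfl
    · intro x y z w hxy hyz hxz hzw h1 h2 hr
      rcases (hadj x z).1 hr with hr | ⟨rfl, rfl⟩ | ⟨rfl, rfl⟩
      · exact h.chord x y z w hxy hyz hxz hzw h1 h2 hr
      · rcases hNb y hxy with rfl | rfl
        · exact hyz.ne rfl
        · exact gac hyz
      · rcases hNb y hyz.symm with rfl | rfl
        · exact hxy.ne rfl
        · exact gac hxy.symm
    · intro x y z w hxy hyz hxz hzw h1 h2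
      exact (h.pendant x y z w hxy hyz hxz hzw h1 h2).imp (fun h => Or.inl h) (fun h => Or.inl h)
    · intro x y z w u h1 h2 h3 h4 h5 h6 h7 h8 h9
      exact (h.branch x y z w u h1 h2 h3 h4 h5 h6 h7 h8 h9).imp
        (fun h => Or.inl h) (fun h => Or.inl h)
  exact nbc (hR.le_of_ge hnew le_sup_left (Or.inr (by simp [edge_adj, hbc.ne])))

open scoped Classical in
/-- A finite graph fails to arrow `(P₃, P₄)` iff the 2-CNF constraints are satisfiable. -/
theorem not_arrows_iff_exists_isRedGraph {V : Type} [Finite V] (G : SimpleGraph V) :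
    ¬ Arrows G (pathGraph 3) (pathGraph 4) ↔ ∃ R, IsRedGraph G R := by
  rw [arrows_iff_not_exists_isGoodColoring, not_not]
  constructor
  · rintro ⟨c, hc⟩
    exact ⟨_, hc.isRedGraph⟩
  · rintro ⟨R₀, hR₀⟩
    obtain ⟨R, -, hR⟩ := (Set.toFinite {R | IsRedGraph G R}).exists_le_maximal hR₀
    replace hR : Maximal (IsRedGraph G) R := hR
    obtain ⟨col, hcol⟩ : ∃ c : G.EdgeLabeling EdgeColor, ∀ x y (h : G.Adj x y),
        c ⟨s(x, y), h⟩ = if R.Adj x y then .red else .blue :=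
      ⟨fun e => if e.1 ∈ R.edgeSet then .red else .blue, fun x y h => rfl⟩
    have hred : ∀ x y, (col.labelGraph .red).Adj x y → R.Adj x y := by
      intro x y h
      obtain ⟨h, hc⟩ := (EdgeLabeling.labelGraph_adj x y).1 h
      by_contra hn
      simp [hcol, hn] at hc
    have hblue : ∀ x y, (col.labelGraph .blue).Adj x y → G.Adj x y ∧ ¬ R.Adj x y := by
      intro x y h
      obtain ⟨h, hc⟩ := (EdgeLabeling.labelGraph_adj x y).1 h
      refine ⟨h, fun hn => ?_⟩
      simp [hcol, hn] at hc
    refine ⟨col, ?_, ?_⟩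
    · rw [SimpleGraph.Free, pathGraph_three_isContained_iff]
      rintro ⟨a, b, c, hab, hbc, hac⟩
      exact hac (hR.prop.matching b a c (hred _ _ hab).symm (hred _ _ hbc))
    · rw [SimpleGraph.Free, pathGraph_four_isContained_iff]
      rintro ⟨a, b, c, d, hab, hbc, hcd, hac, had, hbd⟩
      obtain ⟨gab, nab⟩ := hblue _ _ hab
      obtain ⟨gbc, nbc⟩ := hblue _ _ hbc
      obtain ⟨gcd, ncd⟩ := hblue _ _ hcd
      have := IsRedGraph.exists_adj_of_maximal hR gab gbc gcd hac had hbd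
      tauto

/-- A literal over the variables `α`: a variable with the truth value that satisfies it. -/
abbrev Literal (α : Type) : Type := α × Bool

/-- The complementary literal. -/
def Literal.neg {α : Type} (l : Literal α) : Literal α := (l.1, !l.2)

@[simp] theorem Literal.neg_neg {α : Type} (l : Literal α) : l.neg.neg = l := by
  simp [Literal.neg]

/-- Satisfiability of the 2-CNF whose clauses are the pairs of literals related by `C`. -/
def Satisfiable {α : Type} (C : Literal α → Literal α → Prop) : Prop :=
  ∃ x : α → Bool, ∀ l m, C l m → x l.1 = l.2 ∨ x m.1 = m.2

/-- The edges of the implication graph of a 2-CNF. -/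
def Implies {α : Type} (C : Literal α → Literal α → Prop) (l m : Literal α) : Prop :=
  C l.neg m ∨ C m l.neg

/-- Reachability in the implication graph of a 2-CNF. -/
abbrev ImpliesStar {α : Type} (C : Literal α → Literal α → Prop) :
    Literal α → Literal α → Prop :=
  Relation.ReflTransGen (Implies C)

theorem Implies.neg {α : Type} {C : Literal α → Literal α → Prop} {l m : Literal α}
    (h : Implies C l m) : Implies C m.neg l.neg := by
  unfold Implies at *
  rw [Literal.neg_neg]
  exact h.symm

theorem ImpliesStar.neg {α : Type} {C : Literal α → Literal α → Prop} {l m : Literal α}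
    (h : ImpliesStar C l m) : ImpliesStar C m.neg l.neg := by
  induction h with
  | refl => exact .refl
  | tail _ h ih => exact .head h.neg ih

/-- The set of literals is closed under implication and contains no complementary pair. -/
structure IsConsistent {α : Type} (C : Literal α → Literal α → Prop) (S : Set (Literal α)) :
    Prop where
  closed : ∀ l m, l ∈ S → Implies C l m → m ∈ S
  neg_notMem : ∀ l ∈ S, l.neg ∉ S

theorem IsConsistent.mem_of_impliesStar {α : Type} {C : Literal α → Literal α → Prop}
    {S : Set (Literal α)} (hS : IsConsistent C S) {l m : Literal α} (hl : l ∈ S)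
    (h : ImpliesStar C l m) : m ∈ S := by
  induction h with
  | refl => exact hl
  | tail _ h ih => exact hS.closed _ _ ih h

/-- A 2-CNF is unsatisfiable iff some variable and its negation imply each other. If there is no
such variable, a maximal consistent set of literals contains a literal of each variable, and so
gives a satisfying assignment. -/
theorem not_satisfiable_iff {α : Type} (C : Literal α → Literal α → Prop) :
    ¬ Satisfiable C ↔
      ∃ a, ImpliesStar C (a, true) (a, false) ∧ ImpliesStar C (a, false) (a, true) := by
  constructor
  · intro hC
    by_contra! hno
    obtain ⟨S, hS⟩ : ∃ S, Maximal (IsConsistent C) S := by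
      refine zorn_subset {S | IsConsistent C S} fun c hc hchain => ?_
      refine ⟨⋃₀ c, ⟨?_, ?_⟩, fun s hs => Set.subset_sUnion_of_mem hs⟩
      · rintro l m ⟨s, hs, hl⟩ hlm
        exact ⟨s, hs, (hc hs).closed _ _ hl hlm⟩
      · rintro l ⟨s, hs, hl⟩ ⟨t, ht, hl'⟩
        rcases hchain.total hs ht with h | h
        · exact (hc ht).neg_notMem l (h hl) hl'
        · exact (hc hs).neg_notMem l hl (h hl')
    -- otherwise `S` could be extended by all literals that `l` implies
    have key : ∀ l : Literal α, ¬ ImpliesStar C l l.neg → l.neg ∉ S → l ∈ S := by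
      intro l hl hlS
      have : IsConsistent C (S ∪ {m | ImpliesStar C l m}) := by
        refine ⟨?_, ?_⟩
        · rintro p m (hp | hp) hpm
          · exact Or.inl (hS.prop.closed _ _ hp hpm)
          · exact Or.inr (Relation.ReflTransGen.tail hp hpm)
        · rintro p (hp | hp) (hp' | hp')
          · exact hS.prop.neg_notMem p hp hp'
          · have := ImpliesStar.neg hp'
            rw [Literal.neg_neg] at this
            exact hlS (hS.prop.mem_of_impliesStar hp this)
          · exact hlS (hS.prop.mem_of_impliesStar hp' (ImpliesStar.neg hp))
          · have := ImpliesStar.neg hp'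
            rw [Literal.neg_neg] at this
            exact hl (Relation.ReflTransGen.trans hp this)
      exact hS.le_of_ge this Set.subset_union_left (Or.inr .refl)
    have htot : ∀ a, (a, true) ∈ S ∨ (a, false) ∈ S := by
      intro a
      by_contra! hn
      exact hno a (by_contra fun h => hn.1 (key (a, true) h hn.2))
        (by_contra fun h => hn.2 (key (a, false) h hn.1))
    classical
    refine hC ⟨fun a => decide ((a, true) ∈ S), fun l m hlm => ?_⟩
    have hval : ∀ l : Literal α, decide ((l.1, true) ∈ S) ≠ l.2 → l.neg ∈ S := by
      rintro ⟨a, _ | _⟩ h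
      · simpa [Literal.neg] using h
      · exact (htot a).resolve_left (by simpa using h)
    by_contra! hn
    have h1 := hS.prop.closed _ m (hval l hn.1) (Or.inl (by rwa [Literal.neg_neg]))
    exact hS.prop.neg_notMem _ h1 (hval m hn.2)
  · rintro ⟨a, h1, h2⟩ ⟨x, hx⟩
    have step : ∀ l m, Implies C l m → x l.1 = l.2 → x m.1 = m.2 := by
      intro l m hlm hl
      have hneg : ¬ x l.neg.1 = l.neg.2 := by simp [Literal.neg, hl]
      rcases hlm with h | h
      · exact (hx _ _ h).resolve_left hneg
      · exact (hx _ _ h).resolve_right hneg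
    have star : ∀ l m, ImpliesStar C l m → x l.1 = l.2 → x m.1 = m.2 := by
      intro l m hlm hl
      induction hlm with
      | refl => exact hl
      | tail _ h ih => exact step _ _ h ih
    cases h : x a
    · have := star _ _ h2 h
      simp_all
    · have := star _ _ h1 h
      simp_all

end PathArrowing

/-! ### Structured programs over stacks and Turing machines -/

namespace PathArrowing

open Turing Function

/-- A conditional push: a stack, and the bit to push on it, if any, as a function of the variables
and of the last bit popped. -/
abbrev Push (K V : Type) : Type := K × (V → Option Bool → Option Bool)

/-- Structured programs over stacks of bits indexed by `K`, with variables in a finite type `V`.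
`act k f ps` pops stack `k`, performs the pushes `ps` and updates the variables by `f`;
`loop k f ps c` repeats this, each time followed by `c`, until stack `k` is found empty. -/
inductive Code (K V : Type) : Type
  | skip : Code K V
  | act (k : K) (f : V → Option Bool → V) (ps : List (Push K V)) : Code K V
  | loop (k : K) (f : V → Option Bool → V) (ps : List (Push K V)) (c : Code K V) : Code K V
  | seq (c d : Code K V) : Code K V

/-- The stacks after the pushes `ps`. -/
def pushAll {K V : Type} [DecidableEq K] (v : V) (o : Option Bool) :
    List (Push K V) → (K → List Bool) → K → List Bool
  | [], S => S
  | p :: ps, S => pushAll v o ps (update S p.1 ((p.2 v o).toList ++ S p.1))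

namespace Code

variable {K V : Type}

/-- The labels of the machine that executes a program. -/
def Lbl : Code K V → Type
  | skip => Unit
  | act _ _ _ => Unit
  | loop _ _ _ c => Option c.Lbl
  | seq c d => c.Lbl ⊕ d.Lbl

/-- The label at which the execution of a program starts. -/
def entry : (c : Code K V) → c.Lbl
  | skip => ()
  | act _ _ _ => ()
  | loop _ _ _ _ => none
  | seq c _ => Sum.inl c.entry

theorem finite_lbl : (c : Code K V) → Finite c.Lbl
  | skip => inferInstanceAs (Finite Unit)
  | act _ _ _ => inferInstanceAs (Finite Unit)
  | loop _ _ _ c => by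
    have := c.finite_lbl
    exact inferInstanceAs (Finite (Option c.Lbl))
  | seq c d => by
    have := c.finite_lbl
    have := d.finite_lbl
    exact inferInstanceAs (Finite (c.Lbl ⊕ d.Lbl))

/-- The machine statement that performs the pushes `ps` and goes on with `q`. The second component
of the machine state holds the last bit popped. -/
def pushStmt {Λ : Type} :
    List (Push K V) → TM2.Stmt (fun _ : K => Bool) Λ (V × Option Bool) →
      TM2.Stmt (fun _ : K => Bool) Λ (V × Option Bool)
  | [], q => q
  | p :: ps, q => .branch (fun s => (p.2 s.1 s.2).isSome)
      (.push p.1 (fun s => (p.2 s.1 s.2).getD false) (pushStmt ps q)) (pushStmt ps q)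

/-- The machine statements of a program whose labels are embedded into `Λ` by `emb`, and which
leaves for the label `exit`. -/
def compile {Λ : Type} : (c : Code K V) → (c.Lbl → Λ) → Λ → c.Lbl →
    TM2.Stmt (fun _ : K => Bool) Λ (V × Option Bool)
  | skip, _, exit, _ => .goto fun _ => exit
  | act k f ps, _, exit, _ => .pop k (fun s o => (s.1, o))
      (pushStmt ps (.load (fun s => (f s.1 s.2, none)) (.goto fun _ => exit)))
  | loop k f ps c, emb, exit, none => .pop k (fun s o => (s.1, o))
      (.branch (fun s => s.2.isSome)
        (pushStmt ps (.load (fun s => (f s.1 s.2, none)) (.goto fun _ => emb (some c.entry))))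
        (.goto fun _ => exit))
  | loop _ _ _ c, emb, _, some x => c.compile (fun y => emb (some y)) (emb none) x
  | seq c d, emb, _, .inl x => c.compile (fun y => emb (.inl y)) (emb (.inr d.entry)) x
  | seq _ d, emb, exit, .inr x => d.compile (fun y => emb (.inr y)) exit x

end Code

section

variable {K V : Type} [DecidableEq K]

/-- The machine `M` gets from one configuration to another in at most `t` steps. -/
def ReachesIn {Λ : Type} (M : Λ → TM2.Stmt (fun _ : K => Bool) Λ (V × Option Bool))
    (a b : TM2.Cfg (fun _ : K => Bool) Λ (V × Option Bool)) (t : ℕ) : Prop :=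
  ∃ k ≤ t, (flip bind (TM2.step M))^[k] (some a) = some b

theorem ReachesIn.trans {Λ : Type} {M : Λ → TM2.Stmt (fun _ : K => Bool) Λ (V × Option Bool)}
    {a b c : TM2.Cfg (fun _ : K => Bool) Λ (V × Option Bool)} {t u : ℕ}
    (h₁ : ReachesIn M a b t) (h₂ : ReachesIn M b c u) : ReachesIn M a c (t + u) := by
  obtain ⟨k, hk, h₁⟩ := h₁
  obtain ⟨l, hl, h₂⟩ := h₂
  exact ⟨l + k, by omega, by rw [iterate_add_apply, h₁, h₂]⟩

theorem ReachesIn.of_step {Λ : Type} {M : Λ → TM2.Stmt (fun _ : K => Bool) Λ (V × Option Bool)}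
    {a b : TM2.Cfg (fun _ : K => Bool) Λ (V × Option Bool)} (h : TM2.step M a = some b) :
    ReachesIn M a b 1 :=
  ⟨1, le_rfl, h⟩

theorem stepAux_pushStmt {Λ : Type} (v : V) (o : Option Bool) (ps : List (Push K V))
    (q : TM2.Stmt (fun _ : K => Bool) Λ (V × Option Bool)) (S : K → List Bool) :
    TM2.stepAux (Code.pushStmt ps q) (v, o) S = TM2.stepAux q (v, o) (pushAll v o ps S) := by
  induction ps generalizing S with
  | nil => rfl
  | cons p ps ih =>
    cases h : p.2 v o
    · simp [Code.pushStmt, pushAll, h, ih]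
    · simp [Code.pushStmt, pushAll, h, ih]

/-- The program `c`, started with the variables and stacks `s`, ends with `s'` within `t` steps of
any machine in which it is embedded. -/
def Runs (c : Code K V) (s s' : V × (K → List Bool)) (t : ℕ) : Prop :=
  ∀ (Λ : Type) (M : Λ → TM2.Stmt (fun _ : K => Bool) Λ (V × Option Bool)) (emb : c.Lbl → Λ)
    (exit : Λ), (∀ x, M (emb x) = c.compile emb exit x) →
      ReachesIn M ⟨some (emb c.entry), (s.1, none), s.2⟩ ⟨some exit, (s'.1, none), s'.2⟩ t

theorem Runs.mono {c : Code K V} {s s' : V × (K → List Bool)} {t u : ℕ} (h : Runs c s s' t)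
    (htu : t ≤ u) : Runs c s s' u := fun Λ M emb exit hM => by
  obtain ⟨k, hk, h⟩ := h Λ M emb exit hM
  exact ⟨k, hk.trans htu, h⟩

theorem Runs.congr {c : Code K V} {v v' : V} {S S' T T' : K → List Bool} {t : ℕ}
    (h : Runs c (v, S) (v', S') t) (hS : S = T) (hS' : S' = T') : Runs c (v, T) (v', T') t :=
  hS ▸ hS' ▸ h

theorem Runs.skip (s : V × (K → List Bool)) : Runs .skip s s 1 := fun Λ M emb exit hM => by
  apply ReachesIn.of_step
  simp [TM2.step, hM, Code.compile]

theorem Runs.act (k : K) (f : V → Option Bool → V) (ps : List (Push K V)) (v : V)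
    (S : K → List Bool) : Runs (.act k f ps) (v, S)
      (f v (S k).head?, pushAll v (S k).head? ps (update S k (S k).tail)) 1 :=
  fun Λ M emb exit hM => by
    apply ReachesIn.of_step
    simp [TM2.step, hM, Code.compile, stepAux_pushStmt]

theorem Runs.seq {c d : Code K V} {s s' s'' : V × (K → List Bool)} {t u : ℕ} (h₁ : Runs c s s' t)
    (h₂ : Runs d s' s'' u) : Runs (.seq c d) s s'' (t + u) := fun Λ M emb exit hM =>
  (h₁ Λ M (fun y => emb (.inl y)) (emb (.inr d.entry)) fun x => hM (.inl x)).trans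
    (h₂ Λ M (fun y => emb (.inr y)) exit fun x => hM (.inr x))

theorem Runs.loop_nil {k : K} (f : V → Option Bool → V) (ps : List (Push K V)) (c : Code K V)
    (v : V) {S : K → List Bool} (hS : S k = []) : Runs (.loop k f ps c) (v, S) (v, S) 1 :=
  fun Λ M emb exit hM => by
    apply ReachesIn.of_step
    have : update S k [] = S := by rw [← hS, update_eq_self]
    rw [TM2.step, hM]
    simp [Code.entry, Code.compile, hS, this]

theorem Runs.loop_cons {k : K} {f : V → Option Bool → V} {ps : List (Push K V)} {c : Code K V}
    {v : V} {S : K → List Bool} {b : Bool} {l : List Bool} {s' s'' : V × (K → List Bool)}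
    {t u : ℕ} (hS : S k = b :: l)
    (h₁ : Runs c (f v (some b), pushAll v (some b) ps (update S k l)) s' t)
    (h₂ : Runs (.loop k f ps c) s' s'' u) : Runs (.loop k f ps c) (v, S) s'' (1 + t + u) :=
  fun Λ M emb exit hM => by
    refine (ReachesIn.trans (ReachesIn.of_step ?_)
      (h₁ Λ M (fun y => emb (some y)) (emb none) fun x => hM (some x))).trans
      (h₂ Λ M emb exit hM)
    rw [TM2.step, hM]
    simp [Code.entry, Code.compile, hS, stepAux_pushStmt]

end

/-- The machine that executes a program and resets its state before halting. -/
noncomputable def Code.toFinTM2 {K V : Type} [DecidableEq K] [Fintype K] [Fintype V]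
    (c : Code K V) (v₀ : V) (inp out : K) : FinTM2 where
  K := K
  k₀ := inp
  k₁ := out
  Γ _ := Bool
  Λ := Option c.Lbl
  main := some c.entry
  ΛFin := by
    have := c.finite_lbl
    exact Fintype.ofFinite _
  σ := V × Option Bool
  initialState := (v₀, none)
  Γk₀Fin := inferInstanceAs (Fintype Bool)
  m
    | none => .load (fun _ => (v₀, none)) .halt
    | some x => c.compile some none x

/-- A language is in P if a structured program decides it in polynomial time, leaving nothing but
the answer on the stacks. -/
theorem inP_of_runs {K V : Type} [DecidableEq K] [Fintype K] [Fintype V] (c : Code K V) (v₀ : V)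
    (inp out : K) (L : Language Bool) (f : List Bool → Bool) (hf : ∀ w, f w = true ↔ w ∈ L)
    (P : Polynomial ℕ)
    (h : ∀ w, ∃ v', Runs c (v₀, update (fun _ => []) inp w) (v', update (fun _ => []) out [f w])
      (P.eval w.length)) : InP L := by
  refine ⟨f, hf, ⟨⟨⟨c.toFinTM2 v₀ inp out, Equiv.refl Bool, Equiv.refl Bool⟩, P + 1,
    fun w => Classical.choice ?_⟩⟩⟩
  obtain ⟨v', hr⟩ := h w
  have h1 := hr _ (c.toFinTM2 v₀ inp out).m some none fun x => rfl
  have h2 := h1.trans (ReachesIn.of_step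
    (b := ⟨none, (v₀, none), update (fun _ => []) out [f w]⟩) rfl)
  obtain ⟨k, hk, hkk⟩ := h2
  refine ⟨⟨⟨k, ?_⟩, by simpa using hk⟩⟩
  have hin : initList (c.toFinTM2 v₀ inp out) (List.map (Equiv.refl Bool).invFun (id w)) =
      ⟨some (some c.entry), (v₀, none), update (fun _ => []) inp w⟩ := by
    refine congrArg (TM2.Cfg.mk _ _) (funext fun k => ?_)
    change K at k
    have hk : update (fun _ => []) inp w k =
        if _ : k = inp then List.map (Equiv.refl Bool).invFun (id w) else [] := by
      simp [update_apply]
    exact hk.symm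
  have hout : haltList (c.toFinTM2 v₀ inp out)
      (List.map (Equiv.refl Bool).invFun (Computability.encodeBool (f w))) =
      ⟨none, (v₀, none), update (fun _ => []) out [f w]⟩ := by
    refine congrArg (TM2.Cfg.mk _ _) (funext fun k => ?_)
    change K at k
    have hk : update (fun _ => []) out [f w] k = if _ : k = out then [f w] else [] := by
      simp [update_apply]
    exact hk.symm
  rw [hin]
  refine Eq.trans hkk ?_
  exact congrArg some hout.symm

end PathArrowing

/-! ### Programs over arrays of bits -/

namespace PathArrowing

open Function

/-- The stacks used to execute array programs with registers `R` and arrays `X`. Register `r`,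
which takes values up to `n`, is kept in unary on `reg r`, with the complement to `n` on `regAux r`;
`cnt` holds `n` in unary; array `x` is a tape, which consists of the part `left x` before the
position of the head, reversed, and the part `right x` from that position on. -/
inductive Stk (R X : Type) : Type
  | inp | out | cnt | cntAux | tmp
  | reg (r : R) | regAux (r : R)
  | left (x : X) | right (x : X)
  deriving DecidableEq, Fintype

/-- Array programs: `rw x i j f g` reads the cell of array `x` whose row and column are given by the
registers `i` and `j`, updates the variables by `f` and the cell by `g`; `forEach r p` runs `p` with
each of the values `n - 1, …, 0` in register `r`. -/
inductive Prog (R X V : Type) : Type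
  | rw (x : X) (i j : R) (f : V → Bool → V) (g : V → Bool → Bool) : Prog R X V
  | seq (p q : Prog R X V) : Prog R X V
  | forEach (r : R) (p : Prog R X V) : Prog R X V

/-- Square arrays of bits, indexed by `X`. -/
abbrev Arrays (X : Type) : Type := X → ℕ → ℕ → Bool

/-- The arrays after a write. -/
def Arrays.write {X : Type} [DecidableEq X] (a : Arrays X) (x : X) (i j : ℕ) (b : Bool) :
    Arrays X :=
  fun y k l => if y = x ∧ k = i ∧ l = j then b else a y k l

/-- `iterDown F n` applies `F (n - 1)`, …, `F 0` in this order. -/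
def iterDown {σ : Type} (F : ℕ → σ → σ) : ℕ → σ → σ
  | 0, s => s
  | k + 1, s => iterDown F k (F k s)

section

variable {R X V : Type} [DecidableEq R] [DecidableEq X]

/-- The effect of an array program on the variables and arrays, for given register contents. -/
def Prog.denote (n : ℕ) : Prog R X V → (R → ℕ) → V × Arrays X → V × Arrays X
  | rw x i j f g, env, s =>
    (f s.1 (s.2 x (env i) (env j)),
      s.2.write x (env i) (env j) (g s.1 (s.2 x (env i) (env j))))
  | seq p q, env, s => q.denote n env (p.denote n env s)
  | forEach r p, env, s => iterDown (fun i => p.denote n (update env r i)) n s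

/-- The registers used as indices hold values below `n`, and the registers used as loop variables
hold their rest value `n`. -/
def Prog.WellFormed (n : ℕ) : Prog R X V → (R → ℕ) → Prop
  | rw _ i j _ _, env => env i < n ∧ env j < n
  | seq p q, env => p.WellFormed n env ∧ q.WellFormed n env
  | forEach r p, env => env r = n ∧ ∀ i < n, p.WellFormed n (update env r i)

/-- Pops everything from stack `k` and pushes it on stack `l`, running `c` after each transfer. -/
def Code.transferLoop {K : Type} (k l : K) (c : Code K V) : Code K V :=
  .loop k (fun v _ => v) [(l, fun _ o => o)] c

/-- Moves the head of a tape forward by one cell. -/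
def Code.advance (x : X) : Code (Stk R X) V :=
  .act (.right x) (fun v _ => v) [(.left x, fun _ o => o)]

/-- The implementation of an array program on stacks. A cell is accessed by moving the head forward
by `n` cells for each token of the row register and by one for each token of the column register.
A `forEach` takes one token off the register before each run of the body. -/
def Prog.code : Prog R X V → Code (Stk R X) V
  | rw x i j f g =>
    .seq (.transferLoop (.reg i) .tmp
      (.seq (.transferLoop .cnt .cntAux (.advance x)) (.transferLoop .cntAux .cnt .skip))) <|
    .seq (.transferLoop .tmp (.reg i) .skip) <|
    .seq (.transferLoop (.reg j) .tmp (.advance x)) <|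
    .seq (.transferLoop .tmp (.reg j) .skip) <|
    .seq (.act (.right x) (fun v o => f v (o.getD false))
      [(.right x, fun v o => some (g v (o.getD false)))])
    (.transferLoop (.left x) (.right x) .skip)
  | seq p q => .seq p.code q.code
  | forEach r p => .seq (.transferLoop (.reg r) (.regAux r) p.code)
      (.transferLoop (.regAux r) (.reg r) .skip)

/-- A bound on the running time of an array program, as a polynomial in `n`. -/
noncomputable def Prog.cost : Prog R X V → Polynomial ℕ
  | rw _ _ _ _ _ => 6 * Polynomial.X ^ 2 + 9 * Polynomial.X + 6
  | seq p q => p.cost + q.cost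
  | forEach _ p => Polynomial.X * (p.cost + 3) + 2

/-- The entries of an `n × n` array, row by row. -/
def cells (n : ℕ) (a : ℕ → ℕ → Bool) : List Bool :=
  (List.range (n * n)).map fun p => a (p / n) (p % n)

/-- The stacks that represent given registers and arrays, with all heads at the start. -/
def layout (n : ℕ) (env : R → ℕ) (a : Arrays X) : Stk R X → List Bool
  | .cnt => List.replicate n true
  | .reg r => List.replicate (env r) true
  | .regAux r => List.replicate (n - env r) true
  | .right x => cells n (a x)
  | _ => []

theorem runs_transferLoop_skip {K : Type} [DecidableEq K] {k l : K} (hkl : k ≠ l) (v : V)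
    (S : K → List Bool) :
    Runs (.transferLoop k l .skip) (v, S)
      (v, update (update S k []) l ((S k).reverse ++ S l)) (2 * (S k).length + 1) := by
  generalize hL : S k = L
  induction L generalizing S with
  | nil =>
    have h : update (update S k []) l ([] ++ S l) = S := by
      rw [← hL, update_eq_self, hL]; simp
    rw [List.reverse_nil, h]
    exact Runs.loop_nil _ _ _ _ hL
  | cons b L ih =>
    refine (Runs.loop_cons hL (Runs.skip _) ?_).mono (t := 1 + 1 + (2 * L.length + 1))
      (by simp; omega)
    refine (ih (update (update S k L) l (b :: S l)) (by simp [hkl])).congr ?_ ?_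
    · simp [pushAll, hkl.symm]
    · funext z
      simp only [update_apply]
      split_ifs <;> simp_all

/-- The stacks `S` with the tape `x` replaced by one with content `C` and head position `p`. -/
def atPos (S : Stk R X → List Bool) (x : X) (C : List Bool) (p : ℕ) : Stk R X → List Bool :=
  update (update S (.left x) (C.take p).reverse) (.right x) (C.drop p)

theorem runs_transferLoop_advance {k l : Stk R X} {x : X} (hkl : k ≠ l) (hk : k ≠ .left x)
    (hk' : k ≠ .right x) (hl : l ≠ .left x) (hl' : l ≠ .right x) (v : V)
    (S : Stk R X → List Bool) (C : List Bool) (p : ℕ) (hp : p + (S k).length ≤ C.length) :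
    Runs (.transferLoop k l (.advance x)) (v, atPos S x C p)
      (v, atPos (update (update S k []) l ((S k).reverse ++ S l)) x C (p + (S k).length))
      (2 * (S k).length + 1) := by
  generalize hL : S k = L at hp ⊢
  induction L generalizing S p with
  | nil =>
    have h : update (update S k []) l ([] ++ S l) = S := by
      rw [← hL, update_eq_self, hL]; simp
    rw [List.reverse_nil, h]
    exact Runs.loop_nil _ _ _ _ (by simp [atPos, hk, hk', hL])
  | cons b L ih =>
    have hp' : p < C.length := by simp at hp; omega
    refine (Runs.loop_cons (b := b) (l := L) (by simp [atPos, hk, hk', hL]) (Runs.act _ _ _ _ _)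
      ?_).mono (t := 1 + 1 + (2 * L.length + 1)) (by simp; omega)
    refine (ih (update (update S k L) l (b :: S l)) (p + 1) (by simp [hkl])
      (by simp at hp; omega)).congr ?_ ?_
    · funext z
      simp only [pushAll, atPos, update_apply]
      rw [List.take_succ_eq_append_getElem hp']
      split_ifs <;> simp_all
    · funext z
      rw [List.length_cons, ← Nat.add_assoc, Nat.add_right_comm]
      simp only [atPos, update_apply]
      split_ifs <;> simp_all

end

end PathArrowing

/-! ### Execution of array programs on stacks -/

namespace PathArrowing

open Function

section

variable {R X V : Type} [DecidableEq R] [DecidableEq X]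

/-- Moving the head forward by one row. -/
theorem runs_advance_row {x : X} (v : V) (S : Stk R X → List Bool) (C : List Bool) (p n : ℕ)
    (hcnt : S .cnt = List.replicate n true) (haux : S .cntAux = []) (hp : p + n ≤ C.length) :
    Runs (.seq (.transferLoop .cnt .cntAux (.advance x)) (.transferLoop .cntAux .cnt .skip))
      (v, atPos S x C p) (v, atPos S x C (p + n)) (4 * n + 2) := by
  have h1 := runs_transferLoop_advance (k := .cnt) (l := .cntAux) (x := x) (by simp) (by simp)
    (by simp) (by simp) (by simp) v S C p (by simpa [hcnt] using hp)
  have h2 := runs_transferLoop_skip (V := V) (k := .cntAux) (l := .cnt) (by simp) v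
    (atPos (update (update S .cnt []) .cntAux ((S .cnt).reverse ++ S .cntAux)) x C
      (p + (S .cnt).length))
  refine ((h1.seq h2).mono ?_).congr rfl ?_
  · simp [atPos, hcnt, haux]; omega
  · funext z
    simp only [atPos, update_apply, hcnt, haux]
    split_ifs <;> simp_all

/-- Moving the head forward by one row for each token on stack `k`. -/
theorem runs_advance_rows {k : Stk R X} {x : X} (hk : k ≠ .tmp) (hk₁ : k ≠ .cnt)
    (hk₂ : k ≠ .cntAux) (hk₃ : k ≠ .left x) (hk₄ : k ≠ .right x) (v : V)
    (S : Stk R X → List Bool) (C : List Bool) (n e p : ℕ)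
    (hcnt : S .cnt = List.replicate n true) (haux : S .cntAux = [])
    (he : S k = List.replicate e true) (hp : p + e * n ≤ C.length) :
    Runs (.transferLoop k .tmp (.seq (.transferLoop .cnt .cntAux (.advance x))
        (.transferLoop .cntAux .cnt .skip)))
      (v, atPos S x C p)
      (v, atPos (update (update S k []) .tmp (List.replicate e true ++ S .tmp)) x C (p + e * n))
      (e * (4 * n + 3) + 1) := by
  induction e generalizing S p with
  | zero =>
    refine (Runs.loop_nil _ _ _ _ (by simp [atPos, hk₃, hk₄, he])).congr rfl ?_ |>.mono (by omega)
    funext z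
    simp only [atPos, update_apply]
    split_ifs <;> simp_all
  | succ e ih =>
    have hp' : p + n + e * n ≤ C.length := by rw [Nat.succ_mul] at hp; omega
    refine (Runs.loop_cons (b := true) (l := List.replicate e true)
      (s' := (v, atPos (update (update S k (List.replicate e true)) .tmp (true :: S .tmp)) x C
        (p + n))) (by simp [atPos, hk₃, hk₄, he, List.replicate_succ]) ?_ ?_).mono
      (t := 1 + (4 * n + 2) + (e * (4 * n + 3) + 1)) (by ring_nf; omega)
    · refine (runs_advance_row (x := x) v
        (update (update S k (List.replicate e true)) .tmp (true :: S .tmp)) C p n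
        (by simp [hk₁.symm, hcnt]) (by simp [hk₂.symm, haux])
        (by omega)).congr ?_ rfl
      funext z
      simp only [pushAll, atPos, update_apply]
      split_ifs <;> simp_all
    · refine (ih (update (update S k (List.replicate e true)) .tmp (true :: S .tmp)) (p + n)
        (by simp [hk₁.symm, hcnt]) (by simp [hk₂.symm, haux])
        (by simp [hk]) hp').congr rfl ?_
      funext z
      rw [Nat.succ_mul, Nat.add_comm (e * n), ← Nat.add_assoc]
      simp only [atPos, update_apply]
      split_ifs <;> simp_all [List.replicate_succ']

theorem length_cells (n : ℕ) (a : ℕ → ℕ → Bool) : (cells n a).length = n * n := by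
  simp [cells]

theorem index_lt {n i j : ℕ} (hi : i < n) (hj : j < n) : i * n + j < n * n := by
  nlinarith

theorem cells_getElem (n : ℕ) (a : ℕ → ℕ → Bool) {i j : ℕ} (hj : j < n)
    (h : i * n + j < (cells n a).length) : (cells n a)[i * n + j] = a i j := by
  have hn : 0 < n := by omega
  simp [cells, Nat.mul_comm i n, Nat.mul_add_div hn, Nat.div_eq_of_lt hj,
    Nat.mod_eq_of_lt hj]

theorem cells_set (n : ℕ) (a : Arrays X) (x : X) {i j : ℕ} (hi : i < n) (hj : j < n) (b : Bool) :
    (cells n (a x)).set (i * n + j) b = cells n (a.write x i j b x) := by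
  have hn : 0 < n := by omega
  refine List.ext_getElem (by simp [length_cells]) fun p h1 h2 => ?_
  rw [List.getElem_set]
  simp only [cells, List.getElem_map, List.getElem_range, Arrays.write, true_and]
  by_cases h : i * n + j = p
  · subst h
    simp [Nat.mul_comm i n, Nat.mul_add_div hn, Nat.div_eq_of_lt hj, Nat.mod_eq_of_lt hj]
  · have : ¬ (p / n = i ∧ p % n = j) := by
      rintro ⟨rfl, rfl⟩
      exact h (Nat.div_add_mod' p n)
    simp [h, this]

/-- Access to the cell under the head. -/
theorem runs_act_atPos (x : X) (f : V → Bool → V) (g : V → Bool → Bool) (v : V)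
    (S : Stk R X → List Bool) (C : List Bool) (p : ℕ) (hp : p < C.length) :
    Runs (.act (.right x) (fun v o => f v (o.getD false))
        [(.right x, fun v o => some (g v (o.getD false)))])
      (v, atPos S x C p) (f v C[p], atPos S x (C.set p (g v C[p])) p) 1 := by
  have h := Runs.act (.right x) (fun v o => f v (o.getD false))
    [(.right x, fun v o => some (g v (o.getD false)))] v (atPos S x C p)
  have hhead : (atPos S x C p (.right x)).head? = some C[p] := by
    simp [atPos, hp]
  rw [hhead] at h
  refine h.congr rfl ?_
  have h1 : (C.set p (g v C[p])).drop p = g v C[p] :: C.drop (p + 1) := by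
    rw [List.drop_set, if_neg (lt_irrefl p), Nat.sub_self, List.drop_eq_getElem_cons hp,
      List.set_cons_zero]
  funext z
  simp only [pushAll, atPos, update_apply, h1, List.take_set_of_le (le_refl p)]
  split_ifs <;> simp_all

/-- Moving the head back to the start. -/
theorem runs_rewind (x : X) (v : V) (S : Stk R X → List Bool) (C : List Bool) (p : ℕ)
    (hS : S (.left x) = []) :
    Runs (.transferLoop (.left x) (.right x) .skip) (v, atPos S x C p)
      (v, update S (.right x) C) (2 * p + 1) := by
  refine ((runs_transferLoop_skip (k := (.left x : Stk R X)) (l := .right x) (by simp) v _).mono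
    ?_).congr rfl ?_
  · simp [atPos]
  · funext z
    simp only [atPos, update_apply]
    split_ifs <;> simp_all

/-- Restoring a register from `tmp`. -/
theorem runs_restore (r : R) (x : X) (v : V) (S : Stk R X → List Bool) (C : List Bool) (p e : ℕ)
    (hr : S (.reg r) = List.replicate e true) (ht : S .tmp = []) :
    Runs (.transferLoop .tmp (.reg r) .skip)
      (v, atPos (update (update S (.reg r) []) .tmp (List.replicate e true)) x C p)
      (v, atPos S x C p) (2 * e + 1) := by
  refine ((runs_transferLoop_skip (k := (.tmp : Stk R X)) (l := .reg r) (by simp) v _).mono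
    ?_).congr rfl ?_
  · simp [atPos]
  · funext z
    simp only [atPos, update_apply]
    split_ifs <;> simp_all

theorem layout_write (n : ℕ) (env : R → ℕ) (a : Arrays X) (x : X) {i j : ℕ} (hi : i < n)
    (hj : j < n) (b : Bool) :
    update (layout n env a) (.right x) ((cells n (a x)).set (i * n + j) b) =
      layout n env (a.write x i j b) := by
  rw [cells_set n a x hi hj]
  funext z
  cases z with
  | right y =>
    by_cases h : y = x
    · subst h; simp [layout]
    · have : a.write x i j b y = a y := by funext k l; simp [Arrays.write, h]
      simp [layout, h, this]
  | _ => simp [layout]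

theorem runs_code_rw (n : ℕ) (x : X) (i j : R) (f : V → Bool → V) (g : V → Bool → Bool)
    (env : R → ℕ) (hi : env i < n) (hj : env j < n) (v : V) (a : Arrays X) :
    Runs (Prog.rw x i j f g).code (v, layout n env a)
      (f v (a x (env i) (env j)),
        layout n env (a.write x (env i) (env j) (g v (a x (env i) (env j)))))
      (6 * n ^ 2 + 9 * n + 6) := by
  set S := layout n env a with hS
  set C := cells n (a x) with hC
  set p := env i * n + env j with hpdef
  have hlen : C.length = n * n := length_cells _ _
  have hp : p < C.length := by rw [hlen]; exact index_lt hi hj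
  have h0 : S = atPos S x C 0 := by
    funext z
    simp only [atPos, update_apply]
    split_ifs <;> simp_all [layout]
  have h1 := runs_advance_rows (k := .reg i) (x := x) (by simp) (by simp) (by simp) (by simp)
    (by simp) v S C n (env i) 0 rfl rfl rfl (by omega)
  have h2 := runs_restore i x v S C (0 + env i * n) (env i) rfl rfl
  have h3 := runs_transferLoop_advance (k := .reg j) (l := .tmp) (x := x) (by simp) (by simp)
    (by simp) (by simp) (by simp) v S C (env i * n) (by simp [hS, layout]; omega)
  have h4 := runs_restore j x v S C p (env j) rfl rfl
  have h5 := runs_act_atPos x f g v S C p hp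
  have hget : C[p] = a x (env i) (env j) := cells_getElem n (a x) hj hp
  rw [hget] at h5
  have h6 := runs_rewind x (f v (a x (env i) (env j))) S
    (C.set p (g v (a x (env i) (env j)))) p rfl
  refine ((h1.congr h0.symm ?_).seq (h2.seq ((h3.congr ?_ ?_).seq (h4.seq
    (h5.seq (h6.congr rfl (layout_write n env a x hi hj _))))))).mono ?_
  · simp [hS, layout]
  · simp
  · simp [hS, layout, hpdef]
  · have : env i * (4 * n + 3) ≤ n * (4 * n + 3) := Nat.mul_le_mul_right _ hi.le
    have : (S (.reg j)).length = env j := by simp [hS, layout]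
    rw [hlen] at hp
    nlinarith

/-- The implementation of an array program has the effect of the program, within the time bound. -/
theorem runs_code (n : ℕ) (p : Prog R X V) (env : R → ℕ) (hp : p.WellFormed n env)
    (henv : ∀ r, env r ≤ n) (s : V × Arrays X) :
    Runs p.code (s.1, layout n env s.2)
      ((p.denote n env s).1, layout n env (p.denote n env s).2) (p.cost.eval n) := by
  induction p generalizing env s with
  | rw x i j f g =>
    refine (runs_code_rw n x i j f g env hp.1 hp.2 s.1 s.2).mono ?_
    simp [Prog.cost]
  | seq p q ihp ihq =>
    refine ((ihp env hp.1 henv s).seq (ihq env hp.2 henv _)).mono ?_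
    simp [Prog.cost]
  | forEach r p ih =>
    obtain ⟨hr, hp⟩ := hp
    have loop : ∀ k ≤ n, ∀ s : V × Arrays X,
        Runs (.transferLoop (.reg r) (.regAux r) p.code) (s.1, layout n (update env r k) s.2)
          ((iterDown (fun i => p.denote n (update env r i)) k s).1,
            layout n (update env r 0) (iterDown (fun i => p.denote n (update env r i)) k s).2)
          (k * (p.cost.eval n + 1) + 1) := by
      intro k
      induction k with
      | zero =>
        intro _ s
        exact (Runs.loop_nil _ _ _ _ (by simp [layout])).mono (by omega)
      | succ k ihk =>
        intro hk s
        refine (Runs.loop_cons (b := true) (l := List.replicate k true)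
          (by simp [layout, List.replicate_succ])
          ((ih (update env r k) (hp k hk) ?_ s).congr ?_ rfl) (ihk (by omega) _)).mono ?_
        · intro q
          by_cases h : q = r
          · subst h; simp; omega
          · simp [h, henv]
        · funext z
          cases z with
          | reg q => by_cases h : q = r <;> simp [pushAll, layout, h]
          | regAux q =>
            by_cases h : q = r
            · have : n - k = n - (k + 1) + 1 := by omega
              simp [pushAll, layout, update_apply, h, this, List.replicate_succ]
            · simp [pushAll, layout, h]
          | _ => simp [pushAll, layout]
        · ring_nf; omega
    have h1 := loop n le_rfl s
    have h2 := runs_transferLoop_skip (k := .regAux r) (l := .reg r) (by simp)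
      ((Prog.forEach r p).denote n env s).1
      (layout n (update env r 0) ((Prog.forEach r p).denote n env s).2)
    refine ((h1.congr ?_ rfl).seq (h2.congr rfl ?_)).mono ?_
    · rw [← hr, update_eq_self]
    · funext z
      cases z with
      | reg q => by_cases h : q = r <;> simp [layout, h, hr]
      | regAux q => by_cases h : q = r <;> simp [layout, h, hr]
      | _ => simp [layout]
    · simp [Prog.cost, layout]; ring_nf; omega

end

end PathArrowing

/-! ### Parsing the input -/

namespace PathArrowing

open Function

/-- The variables of the decision program: whether the delimiter of the input has been seen, whether
the input has had the right length, the truth value of the current condition, the outcome of the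
first of two searches, and the answer. -/
structure Vars : Type where
  seen : Bool
  valid : Bool
  ok : Bool
  first : Bool
  ans : Bool
  deriving Fintype

section

theorem pushAll_map {K V : Type} [DecidableEq K] {ι : Type} (h : ι → K) (hh : Injective h)
    (l : List ι) (hl : l.Nodup) (g : ι → V → Option Bool → Option Bool) (v : V) (o : Option Bool)
    (S : K → List Bool) :
    (∀ i ∈ l, pushAll v o (l.map fun i => (h i, g i)) S (h i) = (g i v o).toList ++ S (h i)) ∧
      ∀ z, (∀ i ∈ l, h i ≠ z) → pushAll v o (l.map fun i => (h i, g i)) S z = S z := by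
  induction l generalizing S with
  | nil => simp [pushAll]
  | cons j l ih =>
    obtain ⟨hj, hl⟩ := List.nodup_cons.1 hl
    obtain ⟨ih1, ih2⟩ := ih hl (update S (h j) ((g j v o).toList ++ S (h j)))
    refine ⟨fun i hi => ?_, fun z hz => ?_⟩
    · rcases List.mem_cons.1 hi with rfl | hi
      · have := ih2 (h i) fun k hk e => hj (hh e ▸ hk)
        simpa [pushAll] using this
      · have hij : h i ≠ h j := fun e => hj (hh e ▸ hi)
        have := ih1 i hi
        simpa [pushAll, hij] using this
    · have h1 : h j ≠ z := hz j (by simp)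
      have := ih2 z fun k hk => hz k (by simp [hk])
      simpa [pushAll, h1.symm] using this

/-- A loop over a counter whose body leads from `s i` to `s (i + 1)`. -/
theorem runs_transferLoop_count {K V : Type} [DecidableEq K] {k l : K} (hkl : k ≠ l)
    (c : Code K V) (t m : ℕ) (s : ℕ → V × (K → List Bool))
    (h : ∀ i < m, ∀ a b : List Bool, Runs c ((s i).1, update (update (s i).2 k a) l b)
      ((s (i + 1)).1, update (update (s (i + 1)).2 k a) l b) t) (b : List Bool) :
    Runs (.transferLoop k l c)
      ((s 0).1, update (update (s 0).2 k (List.replicate m true)) l b)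
      ((s m).1, update (update (s m).2 k []) l (List.replicate m true ++ b))
      (m * (t + 1) + 1) := by
  induction m generalizing s b with
  | zero => exact (Runs.loop_nil _ _ _ _ (by simp [hkl])).mono (by omega)
  | succ m ih =>
    refine (Runs.loop_cons (b := true) (l := List.replicate m true)
      (by simp [hkl, List.replicate_succ])
      ((h 0 (by omega) (List.replicate m true) (true :: b)).congr ?_ rfl)
      ((ih (fun i => s (i + 1)) (fun i hi => h (i + 1) (by omega)) (true :: b)).congr rfl ?_)).mono
      ?_
    · funext z
      simp only [pushAll, update_apply]
      split_ifs <;> simp_all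
    · rw [List.replicate_succ', List.append_assoc]
      rfl
    · ring_nf; omega

variable {R X : Type} [DecidableEq R] [DecidableEq X]

/-- Splits the input at the delimiter: the ones before it go to `cnt`, the bits after it go to
`tmp`, in reverse order. -/
def parseCode : Code (Stk R X) Vars :=
  .loop .inp (fun v o => { v with seen := v.seen || o == some false })
    [(.cnt, fun v o => if !v.seen && o == some true then some true else none),
      (.tmp, fun v o => if v.seen then o else none)] .skip

theorem runs_parseCode_seen (v : Vars) (hv : v.seen = true) (w : List Bool)
    (S : Stk R X → List Bool) :
    Runs parseCode (v, update S .inp w)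
      (v, update (update S .inp []) .tmp (w.reverse ++ S .tmp)) (2 * w.length + 1) := by
  induction w generalizing S with
  | nil =>
    refine (Runs.loop_nil _ _ _ _ (by simp)).congr rfl ?_
    funext z
    simp only [update_apply]
    split_ifs <;> simp_all
  | cons b w ih =>
    refine (Runs.loop_cons (b := b) (l := w) (by simp) (Runs.skip _) ?_).mono
      (t := 1 + 1 + (2 * w.length + 1)) (by simp; omega)
    have hv' : ({ v with seen := v.seen || some b == some false } : Vars) = v := by
      cases v; simp_all
    rw [hv']
    refine (ih (update S .tmp (b :: S .tmp))).congr ?_ ?_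
    · funext z
      simp only [pushAll, update_apply, hv]
      split_ifs <;> simp_all
    · funext z
      simp only [update_apply]
      split_ifs <;> simp_all

theorem runs_parseCode (v : Vars) (hv : v.seen = false) (n : ℕ) (seen : Bool) (rest : List Bool)
    (hrest : seen = false → rest = []) (S : Stk R X → List Bool) (hS : S .tmp = []) :
    Runs parseCode
      (v, update S .inp (List.replicate n true ++ if seen then false :: rest else []))
      ({ v with seen := seen },
        update (update (update S .inp []) .tmp rest.reverse) .cnt (List.replicate n true ++ S .cnt))
      (2 * (n + rest.length + 1) + 1) := by
  induction n generalizing S with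
  | zero =>
    cases seen
    · have hr := hrest rfl
      subst hr
      have : ({ v with seen := false } : Vars) = v := by cases v; simp_all
      rw [this]
      refine (Runs.loop_nil _ _ _ _ (by simp)).congr rfl ?_ |>.mono (by omega)
      funext z
      simp only [update_apply]
      split_ifs <;> simp_all
    · refine (Runs.loop_cons (b := false) (l := rest) (by simp) (Runs.skip _) ?_).mono
        (t := 1 + 1 + (2 * rest.length + 1)) (by omega)
      have hv' : ({ v with seen := v.seen || some false == some false } : Vars) =
          { v with seen := true } := by simp
      rw [hv']
      refine (runs_parseCode_seen { v with seen := true } rfl rest S).congr ?_ ?_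
      · funext z
        simp only [pushAll, update_apply, hv]
        split_ifs <;> simp_all
      · funext z
        simp only [update_apply]
        split_ifs <;> simp_all
  | succ n ih =>
    refine (Runs.loop_cons (b := true)
      (l := List.replicate n true ++ if seen then false :: rest else [])
      (by simp [List.replicate_succ]) (Runs.skip _)
      ?_).mono (t := 1 + 1 + (2 * (n + rest.length + 1) + 1)) (by omega)
    have hv' : ({ v with seen := v.seen || some true == some false } : Vars) = v := by
      cases v; simp_all
    rw [hv']
    refine (ih (update S .cnt (true :: S .cnt)) (by simp [hS])).congr ?_ ?_
    · funext z
      simp only [pushAll, update_apply, hv]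
      split_ifs <;> simp_all
    · funext z
      simp only [update_apply, List.replicate_succ']
      split_ifs <;> simp_all

/-- Sets all registers to `n`. -/
noncomputable def fillRegsCode [Fintype R] : Code (Stk R X) Vars :=
  .seq (.loop .cnt (fun v _ => v) ((.cntAux, fun _ o => o) ::
    (Finset.univ : Finset R).toList.map fun r => (.reg r, fun _ o => o)) .skip)
  (.transferLoop .cntAux .cnt .skip)

/-- The stacks when `cnt` holds `n`, `tmp` holds `u` and all registers hold `m`. -/
def regState (c aux m : ℕ) (u : List Bool) : Stk R X → List Bool
  | .cnt => List.replicate c true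
  | .cntAux => List.replicate aux true
  | .tmp => u
  | .reg _ => List.replicate m true
  | _ => []

theorem runs_fillRegsCode [Fintype R] (v : Vars) (n : ℕ) (u : List Bool) :
    Runs (fillRegsCode : Code (Stk R X) Vars) (v, regState n 0 0 u) (v, regState n 0 n u)
      (4 * n + 2) := by
  have h1 : ∀ n m, Runs (.loop .cnt (fun v _ => v) ((.cntAux, fun _ o => o) ::
      (Finset.univ : Finset R).toList.map fun r => (.reg r, fun _ o => o)) .skip)
      (v, (regState n m m u : Stk R X → List Bool)) (v, regState 0 (m + n) (m + n) u)
      (2 * n + 1) := by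
    intro n
    induction n with
    | zero => exact fun m => Runs.loop_nil _ _ _ _ rfl
    | succ n ih =>
      intro m
      refine (Runs.loop_cons (S := regState (n + 1) m m u) (b := true)
        (l := List.replicate n true) rfl (Runs.skip _) ?_).mono (t := 1 + 1 + (2 * n + 1))
        (by omega)
      refine (ih (m + 1)).congr ?_ ?_
      · obtain ⟨p1, p2⟩ := pushAll_map (V := Vars) (Stk.reg : R → Stk R X)
          (fun _ _ h => Stk.reg.inj h) (Finset.univ : Finset R).toList (Finset.nodup_toList _)
          (fun _ _ o => o) v (some true)
          (update (update (regState (n + 1) m m u) .cnt (List.replicate n true)) .cntAux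
            (true :: List.replicate m true))
        funext z
        cases z with
        | reg r =>
          refine Eq.trans ?_ (p1 r (by simp)).symm
          simp [regState, List.replicate_succ]
        | _ =>
          refine Eq.trans ?_ (p2 _ (by simp)).symm
          simp [regState, List.replicate_succ]
      · rw [Nat.add_right_comm, Nat.add_assoc]
  refine ((h1 n 0).seq ((runs_transferLoop_skip (by simp) v _).congr rfl ?_)).mono ?_
  · funext z
    cases z <;> simp [regState]
  · simp [regState]; omega

end

end PathArrowing

/-! ### Filling the arrays, and languages decided by array programs -/

namespace PathArrowing

open Function

section

variable {R X : Type} [DecidableEq R] [DecidableEq X]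

/-- Moves one bit from `tmp` to the tape `x₀`, and extends the other tapes by `false`. The input is
marked invalid if `tmp` is empty. -/
noncomputable def fillCellCode [Fintype X] (x₀ : X) : Code (Stk R X) Vars :=
  .act .tmp (fun v o => { v with valid := v.valid && o.isSome })
    ((Finset.univ : Finset X).toList.map fun x =>
      (.right x, fun _ o => some (decide (x = x₀) && o.getD false)))

/-- Fills all tapes with `n ^ 2` bits; `r₀` serves as a loop counter. -/
noncomputable def fillTapesCode [Fintype X] (x₀ : X) (r₀ : R) : Code (Stk R X) Vars :=
  .seq (.transferLoop .cnt .cntAux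
    (.seq (.transferLoop (.reg r₀) (.regAux r₀) (fillCellCode x₀))
      (.transferLoop (.regAux r₀) (.reg r₀) .skip)))
  (.transferLoop .cntAux .cnt .skip)

/-- The stacks after `p` bits of `u` have been moved to the tape `x₀`. -/
def fillStacks (x₀ : X) (S : Stk R X → List Bool) (u : List Bool) (p : ℕ) : Stk R X → List Bool
  | .tmp => u.drop p
  | .right x => ((List.range p).map fun i => decide (x = x₀) && u.getD i false).reverse
  | z => S z

theorem update_fillStacks (x₀ : X) (S : Stk R X → List Bool) (u : List Bool) (p : ℕ)
    (z : Stk R X) (hz : z ≠ .tmp) (hz' : ∀ x, z ≠ .right x) (l : List Bool) :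
    update (fillStacks x₀ S u p) z l = fillStacks x₀ (update S z l) u p := by
  funext y
  cases y with
  | tmp => simp [fillStacks, hz.symm]
  | right x => simp [fillStacks, (hz' x).symm]
  | _ => simp [fillStacks, update_apply]

/-- The variables after `p` bits of `u` have been moved to a tape. -/
def fillVars (v : Vars) (u : List Bool) (p : ℕ) : Vars :=
  { v with valid := v.valid && decide (p ≤ u.length) }

theorem runs_fillCellCode [Fintype X] (x₀ : X) (v : Vars) (S : Stk R X → List Bool)
    (u : List Bool) (p : ℕ) :
    Runs (fillCellCode x₀) (fillVars v u p, fillStacks x₀ S u p)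
      (fillVars v u (p + 1), fillStacks x₀ S u (p + 1)) 1 := by
  have hhead : (fillStacks x₀ S u p .tmp).head? = u[p]? := by simp [fillStacks]
  have h := Runs.act .tmp (fun v o => { v with valid := v.valid && o.isSome })
    ((Finset.univ : Finset X).toList.map fun x =>
      (.right x, fun _ o => some (decide (x = x₀) && o.getD false))) (fillVars v u p)
      (fillStacks x₀ S u p)
  rw [hhead] at h
  have hv : ({ fillVars v u p with valid := (fillVars v u p).valid && u[p]?.isSome } : Vars) =
      fillVars v u (p + 1) := by
    simp only [fillVars, Vars.mk.injEq, and_true, true_and, Bool.and_assoc]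
    congr 1
    rw [Bool.eq_iff_iff]
    simp
    omega
  rw [hv] at h
  refine h.congr rfl ?_
  obtain ⟨p1, p2⟩ := pushAll_map (V := Vars) (Stk.right : X → Stk R X)
    (fun _ _ h => Stk.right.inj h) (Finset.univ : Finset X).toList (Finset.nodup_toList _)
    (fun x _ o => some (decide (x = x₀) && o.getD false)) (fillVars v u p) u[p]?
    (update (fillStacks x₀ S u p) .tmp (fillStacks x₀ S u p .tmp).tail)
  funext z
  cases z with
  | right x =>
    refine (p1 x (by simp)).trans ?_
    simp [fillStacks, List.range_succ]
  | _ =>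
    refine (p2 _ (by simp)).trans ?_
    simp [fillStacks]

theorem runs_fillTapesCode [Fintype X] (x₀ : X) (r₀ : R) (v : Vars) (S : Stk R X → List Bool)
    (u : List Bool) (n : ℕ) (hc : S .cnt = List.replicate n true) (ha : S .cntAux = [])
    (hr : S (.reg r₀) = List.replicate n true) (hra : S (.regAux r₀) = []) :
    Runs (fillTapesCode x₀ r₀) (fillVars v u 0, fillStacks x₀ S u 0)
      (fillVars v u (n * n), fillStacks x₀ S u (n * n)) (n * (4 * n + 3) + 1 + (2 * n + 1)) := by
  have hrow : ∀ (T : Stk R X → List Bool) p, T (.reg r₀) = List.replicate n true →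
      T (.regAux r₀) = [] →
      Runs (.seq (.transferLoop (.reg r₀) (.regAux r₀) (fillCellCode x₀))
        (.transferLoop (.regAux r₀) (.reg r₀) .skip)) (fillVars v u p, fillStacks x₀ T u p)
        (fillVars v u (p + n), fillStacks x₀ T u (p + n)) (4 * n + 2) := by
    intro T p hT hTa
    have h1 := runs_transferLoop_count (k := .reg r₀) (l := .regAux r₀) (by simp)
      (fillCellCode x₀) 1 n (fun i => (fillVars v u (p + i), fillStacks x₀ T u (p + i)))
      (fun i _ a b => by
        rw [update_fillStacks _ _ _ _ _ (by simp) (by simp),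
          update_fillStacks _ _ _ _ _ (by simp) (by simp),
          update_fillStacks _ _ _ _ _ (by simp) (by simp),
          update_fillStacks _ _ _ _ _ (by simp) (by simp)]
        exact runs_fillCellCode x₀ v _ u (p + i)) []
    have h2 := runs_transferLoop_skip (k := .regAux r₀) (l := .reg r₀) (by simp)
      (fillVars v u (p + n)) (update (update (fillStacks x₀ T u (p + n)) (.reg r₀) [])
        (.regAux r₀) (List.replicate n true ++ []))
    refine ((h1.congr ?_ rfl).seq (h2.congr rfl ?_)).mono ?_
    · have e1 : List.replicate n true = fillStacks x₀ T u (p + 0) (.reg r₀) := by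
        simp [fillStacks, hT]
      have e2 : [] = fillStacks x₀ T u (p + 0) (.regAux r₀) := by simp [fillStacks, hTa]
      simp only [e1, update_eq_self]
      rw [e2, update_eq_self]
      rfl
    · funext z
      cases z with
      | reg r => by_cases h : r = r₀ <;> simp [fillStacks, h, hT]
      | regAux r => by_cases h : r = r₀ <;> simp [fillStacks, h, hTa]
      | _ => simp [fillStacks]
    · simp; omega
  have h1 := runs_transferLoop_count (k := .cnt) (l := .cntAux) (by simp)
    (.seq (.transferLoop (.reg r₀) (.regAux r₀) (fillCellCode x₀))
        (.transferLoop (.regAux r₀) (.reg r₀) .skip)) (4 * n + 2) n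
    (fun i => (fillVars v u (i * n), fillStacks x₀ S u (i * n)))
    (fun i _ a b => by
      rw [update_fillStacks _ _ _ _ _ (by simp) (by simp),
        update_fillStacks _ _ _ _ _ (by simp) (by simp),
        update_fillStacks _ _ _ _ _ (by simp) (by simp),
        update_fillStacks _ _ _ _ _ (by simp) (by simp), Nat.succ_mul]
      exact hrow _ (i * n) (by simp [hr]) (by simp [hra])) []
  have h2 := runs_transferLoop_skip (k := .cntAux) (l := .cnt) (by simp)
    (fillVars v u (n * n)) (update (update (fillStacks x₀ S u (n * n)) .cnt [])
      .cntAux (List.replicate n true ++ []))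
  rw [← Nat.zero_mul n]
  refine ((h1.congr ?_ rfl).seq (h2.congr rfl ?_)).mono ?_
  · have e1 : List.replicate n true = fillStacks x₀ S u (0 * n) .cnt := by
      simp [fillStacks, hc]
    have e2 : [] = fillStacks x₀ S u (0 * n) .cntAux := by simp [fillStacks, ha]
    simp only [e1, update_eq_self]
    rw [e2, update_eq_self]
  · funext z
    cases z <;> simp [fillStacks, hc, ha]
  · simp

/-- Empties `tmp`, and marks the input invalid if there was something left on it. -/
def checkEndCode : Code (Stk R X) Vars :=
  .loop .tmp (fun v _ => { v with valid := false }) [] .skip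

theorem runs_checkEndCode (v : Vars) (S : Stk R X → List Bool) :
    Runs checkEndCode (v, S) ({ v with valid := v.valid && (S .tmp).isEmpty }, update S .tmp [])
      (2 * (S .tmp).length + 1) := by
  generalize hL : S .tmp = L
  induction L generalizing S v with
  | nil =>
    have h : update S .tmp [] = S := by rw [← hL, update_eq_self]
    simp only [List.isEmpty_nil, Bool.and_true, h]
    exact Runs.loop_nil _ _ _ _ hL
  | cons b L ih =>
    refine (Runs.loop_cons hL (Runs.skip _) ?_).mono (t := 1 + 1 + (2 * L.length + 1))
      (by simp; omega)
    have := ih { v with valid := false } (update S .tmp L) (by simp)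
    simp only [Bool.false_and, update_idem] at this
    simp only [Bool.and_false, List.isEmpty_cons]
    exact this

/-- Empties the stacks in a list and pushes the answer on the output stack. -/
def finishCode : List (Stk R X) → Code (Stk R X) Vars
  | [] => .act .out (fun v _ => v) [(.out, fun v _ => some (v.seen && v.valid && v.ans))]
  | k :: ks => .seq (.loop k (fun v _ => v) [] .skip) (finishCode ks)

theorem runs_finishCode (ks : List (Stk R X)) (v : Vars) (S : Stk R X → List Bool) (B : ℕ)
    (hB : ∀ k, (S k).length ≤ B) (hks : ∀ k ∉ ks, S k = []) :
    Runs (finishCode ks) (v, S)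
      (v, update (fun _ => []) .out [v.seen && v.valid && v.ans])
      (ks.length * (2 * B + 1) + 1) := by
  induction ks generalizing S with
  | nil =>
    have hS : S = fun _ => [] := funext fun k => hks k (by simp)
    subst hS
    refine ((Runs.act _ _ _ _ _).mono (by simp)).congr rfl ?_
    simp [pushAll]
  | cons k ks ih =>
    have h1 : ∀ (L : List Bool) (S : Stk R X → List Bool), S k = L →
        Runs (.loop k (fun v _ => v) [] .skip) (v, S) (v, update S k []) (2 * L.length + 1) := by
      intro L
      induction L with
      | nil =>
        intro S hS
        have h : update S k [] = S := by rw [← hS, update_eq_self]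
        rw [h]
        exact Runs.loop_nil _ _ _ _ hS
      | cons b L ihL =>
        intro S hS
        refine (Runs.loop_cons hS (Runs.skip _) ?_).mono (t := 1 + 1 + (2 * L.length + 1))
          (by simp; omega)
        simpa [pushAll] using ihL (update S k L) (by simp)
    refine ((h1 _ S rfl).seq (ih (update S k []) ?_ ?_)).mono ?_
    · intro l
      by_cases h : l = k
      · subst h; simp
      · simpa [h] using hB l
    · intro l hl
      by_cases h : l = k
      · subst h; simp
      · simpa [h] using hks l (by simp [h, hl])
    · have := hB k
      simp only [List.length_cons, Nat.succ_mul]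
      omega

/-- The program that decides a language of encoded matrices by means of the array program `p`, which
finds the input matrix in array `x₀`. -/
noncomputable def decideCode [Fintype R] [Fintype X] (x₀ : X) (r₀ : R) (p : Prog R X Vars) :
    Code (Stk R X) Vars :=
  .seq parseCode <| .seq fillRegsCode <| .seq (fillTapesCode x₀ r₀) <| .seq checkEndCode <|
    .seq p.code <| finishCode (Finset.univ : Finset (Stk R X)).toList

/-- The initial arrays: `x₀` holds the bits `l`, row by row, and all others are zero. The formula
describes what the tapes hold even if `l` does not have length `n ^ 2`. -/
def inputArrays (x₀ : X) (n : ℕ) (l : List Bool) : Arrays X := fun x i j =>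
  decide (x = x₀) && l.reverse.getD (n * n - 1 - (i * n + j)) false

theorem inputArrays_self (x₀ : X) {n : ℕ} {l : List Bool} (hl : l.length = n * n) {i j : ℕ}
    (hi : i < n) (hj : j < n) : inputArrays x₀ n l x₀ i j = l.getD (i * n + j) false := by
  have := index_lt hi hj
  simp only [inputArrays, decide_true, Bool.true_and, List.getD_eq_getElem?_getD]
  rw [List.getElem?_reverse (by omega), hl]
  congr 2
  omega

theorem cells_inputArrays (x₀ x : X) (n : ℕ) (l : List Bool) :
    cells n (inputArrays x₀ n l x) =
      ((List.range (n * n)).map fun i => decide (x = x₀) && l.reverse.getD i false).reverse := by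
  refine List.ext_getElem (by simp [cells]) fun p h1 h2 => ?_
  simp [cells, inputArrays, Nat.div_add_mod']

theorem exists_eq_replicate_append (w : List Bool) : ∃ (n : ℕ) (seen : Bool) (rest : List Bool),
    (seen = false → rest = []) ∧
      w = List.replicate n true ++ if seen then false :: rest else [] := by
  induction w with
  | nil => exact ⟨0, false, [], by simp, by simp⟩
  | cons b w ih =>
    cases b
    · exact ⟨0, true, w, by simp, by simp⟩
    · obtain ⟨n, seen, rest, h, rfl⟩ := ih
      exact ⟨n + 1, seen, rest, h, by simp [List.replicate_succ]⟩

theorem eval_mono_nat (P : Polynomial ℕ) {m n : ℕ} (h : m ≤ n) : P.eval m ≤ P.eval n := by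
  rw [Polynomial.eval_eq_sum, Polynomial.eval_eq_sum]
  exact Finset.sum_le_sum fun i _ => Nat.mul_le_mul_left _ (Nat.pow_le_pow_left h i)

/-- A language is in P if an array program gives the right answer on every input word, split
into its leading ones, the delimiter and the remaining bits. -/
theorem inP_of_prog [Fintype R] [Fintype X] (x₀ : X) (r₀ : R) (p : Prog R X Vars)
    (hwf : ∀ n, p.WellFormed n fun _ => n) (L : Language Bool)
    (h : ∀ (n : ℕ) (seen : Bool) (rest : List Bool), (seen = false → rest = []) →
      ∀ v, v = (p.denote n (fun _ => n)
        (⟨seen, decide (rest.length = n * n), true, false, false⟩, inputArrays x₀ n rest)).1 →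
      ((v.seen && v.valid && v.ans) = true ↔
        (List.replicate n true ++ if seen then false :: rest else []) ∈ L)) : InP L := by
  classical
  refine inP_of_runs (decideCode x₀ r₀ p) ⟨false, true, true, false, false⟩ .inp .out L
    (fun w => decide (w ∈ L)) (by simp)
    ((2 * Polynomial.X + 3) + ((4 * Polynomial.X + 2) +
      ((Polynomial.X * (4 * Polynomial.X + 3) + 1 + (2 * Polynomial.X + 1)) +
      ((2 * Polynomial.X + 1) + (p.cost +
      ((Fintype.card (Stk R X) : Polynomial ℕ) *
        (2 * (Polynomial.X * Polynomial.X + Polynomial.X) + 1) + 1)))))) fun w => ?_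
  obtain ⟨n, seen, rest, hrest, hw⟩ := exists_eq_replicate_append w
  have hn : n + rest.length ≤ w.length := by
    rw [hw]
    cases seen
    · simp [hrest rfl]
    · simp
  have hn' : n ≤ w.length := by omega
  set v₁ : Vars := ⟨seen, true, true, false, false⟩ with hv₁
  set v₂ : Vars := ⟨seen, decide (rest.length = n * n), true, false, false⟩ with hv₂
  set s := p.denote n (fun _ => n) (v₂, inputArrays x₀ n rest) with hs
  have hans := h n seen rest hrest s.1 rfl
  have h1 := runs_parseCode ⟨false, true, true, false, false⟩ rfl n seen rest hrest
    (fun _ : Stk R X => []) rfl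
  have h2 := runs_fillRegsCode (R := R) (X := X) v₁ n rest.reverse
  have h3 := runs_fillTapesCode x₀ r₀ v₁ (regState n 0 n rest.reverse) rest.reverse n
    rfl rfl rfl rfl
  have h4 := runs_checkEndCode (fillVars v₁ rest.reverse (n * n))
    (fillStacks x₀ (regState n 0 n rest.reverse) rest.reverse (n * n) : Stk R X → List Bool)
  have h5 := runs_code n p (fun _ => n) (hwf n) (fun _ => le_rfl) (v₂, inputArrays x₀ n rest)
  have h6 := runs_finishCode (Finset.univ : Finset (Stk R X)).toList s.1
    (layout n (fun _ => n) s.2) (n * n + n) (by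
      intro k
      cases k <;> simp [layout, cells]) (by simp)
  have e0 : fillVars v₁ rest.reverse 0 = v₁ := by simp [fillVars, v₁]
  have e1 : (fillStacks x₀ (regState n 0 n rest.reverse) rest.reverse 0 : Stk R X → List Bool) =
      regState n 0 n rest.reverse := by
    funext z
    cases z <;> simp [fillStacks, regState]
  rw [e0, e1] at h3
  have e2 : ({ fillVars v₁ rest.reverse (n * n) with
      valid := (fillVars v₁ rest.reverse (n * n)).valid &&
        (fillStacks x₀ (regState n 0 n rest.reverse) rest.reverse (n * n)
          (.tmp : Stk R X)).isEmpty } : Vars) = v₂ := by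
    simp only [fillVars, fillStacks, v₁, v₂, Vars.mk.injEq, and_true, true_and]
    rw [Bool.eq_iff_iff]
    simp
    omega
  rw [e2] at h4
  refine ⟨s.1, ((h1.congr ?_ ?_).seq (h2.seq (h3.seq ((h4.congr rfl ?_).seq
    (h5.seq (h6.congr rfl ?_)))))).mono ?_⟩
  · rw [hw]
  · funext z
    cases z <;> simp [regState]
  · funext z
    cases z <;> simp [fillStacks, layout, regState, cells_inputArrays]
  · congr 2
    rw [Bool.eq_iff_iff, hans, hw]
    simp
  · have hc := eval_mono_nat p.cost hn'
    have hlen : (fillStacks x₀ (regState n 0 n rest.reverse) rest.reverse (n * n)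
        (.tmp : Stk R X)).length ≤ w.length := by simp [fillStacks]; omega
    have hsq : n * n ≤ w.length * w.length := Nat.mul_le_mul hn' hn'
    have h4n : n * (4 * n + 3) ≤ w.length * (4 * w.length + 3) := by gcongr
    have hfin : Fintype.card (Stk R X) * (2 * (n * n + n) + 1) ≤
        Fintype.card (Stk R X) * (2 * (w.length * w.length + w.length) + 1) := by gcongr
    simp only [Polynomial.eval_add, Polynomial.eval_mul, Polynomial.eval_X,
      Polynomial.eval_natCast, Nat.cast_id, Polynomial.eval_ofNat, Polynomial.eval_one,
      Finset.length_toList, Finset.card_univ]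
    omega

end

end PathArrowing

/-! ### Loops and guards in array programs -/

namespace PathArrowing

open Function

/-- The input matrices of a 2-CNF template: adjacency and equality of vertices. -/
inductive Base : Type
  | adj | eq
  deriving DecidableEq

instance : Fintype Base := ⟨{.adj, .eq}, fun x => by cases x <;> simp⟩

/-- The arrays of the decision program: the input matrices, and for either truth value the set of
literals of this kind that have been found to be implied. -/
inductive Arr : Type
  | base (x : Base)
  | lit (b : Bool)
  deriving DecidableEq, Fintype

/-- The registers of the decision program: the variables of the clause templates, the pair of
vertices at which a search starts, and two loop counters. -/
inductive Reg : Type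
  | var (i : Fin 5)
  | src | tgt | it₁ | it₂
  deriving DecidableEq, Fintype

/-- A condition that an entry of an array, with indices of type `I`, has the value `b`. -/
structure Cond (I X : Type) : Type where
  x : X
  i : I
  j : I
  b : Bool

/-- The truth of a condition for given indices and arrays. -/
def Cond.Holds {I X : Type} (c : Cond I X) (env : I → ℕ) (a : Arrays X) : Prop :=
  a c.x (env c.i) (env c.j) = c.b

/-- A template for 2-clauses: for all values of its five variables that satisfy the conditions,
one of the two literals is to be true. The propositional variables are pairs of vertices. -/
structure Clause : Type where
  conds : List (Cond (Fin 5) Base)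
  l : Literal (Fin 5 × Fin 5)
  m : Literal (Fin 5 × Fin 5)

/-- A template for implications between literals. -/
structure Rule : Type where
  conds : List (Cond (Fin 5) Base)
  l : Literal (Fin 5 × Fin 5)
  m : Literal (Fin 5 × Fin 5)

/-- An instance of a literal. -/
def instLit (ρ : Fin 5 → ℕ) (l : Literal (Fin 5 × Fin 5)) : Literal (ℕ × ℕ) :=
  ((ρ l.1.1, ρ l.1.2), l.2)

/-- The instances over the vertices `0, …, n - 1` of the given clauses. -/
def Clauses (n : ℕ) (M : Arrays Base) (Φ : List Clause) (l m : Literal (ℕ × ℕ)) : Prop :=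
  ∃ c ∈ Φ, ∃ ρ : Fin 5 → ℕ, (∀ i, ρ i < n) ∧ (∀ q ∈ c.conds, q.Holds ρ M) ∧
    l = instLit ρ c.l ∧ m = instLit ρ c.m

/-- The two implications that are equivalent to a clause. -/
def Clause.rules (c : Clause) : List Rule :=
  [⟨c.conds, c.l.neg, c.m⟩, ⟨c.conds, c.m.neg, c.l⟩]

theorem implies_clauses_iff (n : ℕ) (M : Arrays Base) (Φ : List Clause) (l m : Literal (ℕ × ℕ)) :
    Implies (Clauses n M Φ) l m ↔ ∃ r ∈ Φ.flatMap Clause.rules, ∃ ρ : Fin 5 → ℕ, (∀ i, ρ i < n) ∧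
      (∀ q ∈ r.conds, q.Holds ρ M) ∧ l = instLit ρ r.l ∧ m = instLit ρ r.m := by
  have hneg : ∀ ρ (p : Literal (Fin 5 × Fin 5)) (q : Literal (ℕ × ℕ)),
      q.neg = instLit ρ p ↔ q = instLit ρ p.neg := by
    rintro ρ ⟨p, b⟩ ⟨q, b'⟩
    cases b <;> cases b' <;> simp [instLit, Literal.neg]
  constructor
  · rintro (⟨c, hc, ρ, hρ, hq, hl, hm⟩ | ⟨c, hc, ρ, hρ, hq, hm, hl⟩)
    · exact ⟨⟨c.conds, c.l.neg, c.m⟩, List.mem_flatMap.2 ⟨c, hc, by simp [Clause.rules]⟩, ρ, hρ, hq,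
        (hneg _ _ _).1 hl, hm⟩
    · exact ⟨⟨c.conds, c.m.neg, c.l⟩, List.mem_flatMap.2 ⟨c, hc, by simp [Clause.rules]⟩, ρ, hρ, hq,
        (hneg _ _ _).1 hl, hm⟩
  · rintro ⟨r, hr, ρ, hρ, hq, hl, hm⟩
    obtain ⟨c, hc, hr⟩ := List.mem_flatMap.1 hr
    simp only [Clause.rules, List.mem_cons, List.not_mem_nil, or_false] at hr
    rcases hr with rfl | rfl
    · exact Or.inl ⟨c, hc, ρ, hρ, hq, (hneg _ _ _).2 hl, hm⟩
    · exact Or.inr ⟨c, hc, ρ, hρ, hq, hm, (hneg _ _ _).2 hl⟩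

section Loops

variable {R X V : Type} [DecidableEq R]

/-- Nested loops over the registers in a list. -/
def Prog.forAll (rs : List R) (p : Prog R X V) : Prog R X V :=
  rs.foldr .forEach p

/-- The programs in a list, followed by `last`. -/
def Prog.seqAll (ps : List (Prog R X V)) (last : Prog R X V) : Prog R X V :=
  ps.foldr .seq last

/-- The register contents `env'` arise from `env` by setting the registers in `rs` to values
below `n`. -/
def IsExt (n : ℕ) (rs : List R) (env env' : R → ℕ) : Prop :=
  (∀ r ∈ rs, env' r < n) ∧ ∀ r ∉ rs, env' r = env r

theorem IsExt.cons {n : ℕ} {r : R} {rs : List R} {env env' : R → ℕ} {i : ℕ} (hi : i < n)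
    (h : IsExt n rs (update env r i) env') : IsExt n (r :: rs) env env' := by
  refine ⟨fun q hq => ?_, fun q hq => ?_⟩
  · by_cases hqr : q ∈ rs
    · exact h.1 q hqr
    · rcases List.mem_cons.1 hq with rfl | hq
      · rw [h.2 q hqr, update_self]; exact hi
      · exact absurd hq hqr
  · rw [List.mem_cons, not_or] at hq
    rw [h.2 q hq.2, update_of_ne hq.1]

theorem IsExt.of_cons {n : ℕ} {r : R} {rs : List R} {env env' : R → ℕ}
    (h : IsExt n (r :: rs) env env') : IsExt n rs (update env r (env' r)) env' := by
  refine ⟨fun q hq => h.1 q (by simp [hq]), fun q hq => ?_⟩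
  by_cases hqr : q = r
  · subst hqr; simp
  · rw [update_of_ne hqr, h.2 q (by simp [hqr, hq])]

/-- If each step raises the index of a family of properties by `m`, then `n` steps raise it by
`n * m`. -/
theorem iterDown_counted {σ : Type} (F : ℕ → σ → σ) (I : ℕ → σ → Prop) (m : ℕ) :
    ∀ (n k : ℕ) (s : σ), (∀ i < n, ∀ k s, I k s → I (k + m) (F i s)) → I k s →
      I (k + n * m) (iterDown F n s)
  | 0, k, s, _, h => by simpa [iterDown] using h
  | n + 1, k, s, hF, h => by
    have := iterDown_counted F I m n (k + m) (F n s) (fun i hi => hF i (by omega))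
      (hF n (by omega) k s h)
    rwa [show k + (n + 1) * m = k + m + n * m by ring]

theorem iterDown_hits {σ : Type} (F : ℕ → σ → σ) (I Q : σ → Prop) (i : ℕ) :
    ∀ (n : ℕ) (s : σ), i < n → (∀ j < n, ∀ s, I s → I (F j s)) →
      (∀ j < n, ∀ s, I s → Q s → Q (F j s)) → (∀ s, I s → Q (F i s)) → I s →
      Q (iterDown F n s)
  | n + 1, s, hi, hI, hQ, hF, hs => by
    have hI' : ∀ j < n, ∀ s, I s → I (F j s) := fun j hj => hI j (by omega)
    have hQ' : ∀ j < n, ∀ s, I s → Q s → Q (F j s) := fun j hj => hQ j (by omega)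
    by_cases h : i = n
    · subst h
      exact (iterDown_counted F (fun _ s => I s ∧ Q s) 0 i 0 _
        (fun j hj _ s h => ⟨hI' j hj s h.1, hQ' j hj s h.1 h.2⟩) ⟨hI i hi s hs, hF s hs⟩).2
    · exact iterDown_hits F I Q i n _ (by omega) hI' hQ' hF (hI n (by omega) s hs)

variable {n : ℕ}

theorem Prog.forAll_wellFormed {rs : List R} {p : Prog R X V} {env : R → ℕ} (hrs : rs.Nodup)
    (henv : ∀ r ∈ rs, env r = n) (h : ∀ env', IsExt n rs env env' → p.WellFormed n env') :
    (forAll rs p).WellFormed n env := by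
  induction rs generalizing env with
  | nil => exact h env ⟨by simp, fun _ _ => rfl⟩
  | cons r rs ih =>
    obtain ⟨hr, hrs⟩ := List.nodup_cons.1 hrs
    refine ⟨henv r (by simp), fun i hi => ih hrs (fun q hq => ?_) fun env' he =>
      h env' (he.cons hi)⟩
    rw [update_of_ne (by rintro rfl; exact hr hq)]
    exact henv q (by simp [hq])

theorem Prog.seqAll_wellFormed {ps : List (Prog R X V)} {last : Prog R X V} {env : R → ℕ}
    (h : ∀ p ∈ ps, p.WellFormed n env) (hl : last.WellFormed n env) :
    (seqAll ps last).WellFormed n env := by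
  induction ps with
  | nil => exact hl
  | cons p ps ih => exact ⟨h p (by simp), ih fun q hq => h q (by simp [hq])⟩

variable [DecidableEq X]

/-- An invariant of the body is an invariant of the loops. -/
theorem Prog.forAll_inv {rs : List R} {p : Prog R X V} {env : R → ℕ} {s : V × Arrays X}
    (I : V × Arrays X → Prop)
    (h : ∀ env', IsExt n rs env env' → ∀ s, I s → I (p.denote n env' s)) (hs : I s) :
    I ((forAll rs p).denote n env s) := by
  induction rs generalizing env s with
  | nil => exact h env ⟨by simp, fun _ _ => rfl⟩ s hs
  | cons r rs ih =>
    exact iterDown_counted _ (fun _ s => I s) 0 n 0 s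
      (fun i hi _ s hs => ih (fun env' he => h env' (he.cons hi)) hs) hs

/-- A property that persists and that some run of the body establishes holds after the loops. -/
theorem Prog.forAll_hits {rs : List R} {p : Prog R X V} {env : R → ℕ} {s : V × Arrays X}
    (I Q : V × Arrays X → Prop) {env₀ : R → ℕ} (h₀ : IsExt n rs env env₀)
    (hI : ∀ env', IsExt n rs env env' → ∀ s, I s → I (p.denote n env' s))
    (hQ : ∀ env', IsExt n rs env env' → ∀ s, I s → Q s → Q (p.denote n env' s))
    (hp : ∀ s, I s → Q (p.denote n env₀ s)) (hs : I s) :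
    Q ((forAll rs p).denote n env s) := by
  induction rs generalizing env s with
  | nil =>
    have : env₀ = env := funext fun r => h₀.2 r (by simp)
    subst this
    exact hp s hs
  | cons r rs ih =>
    refine iterDown_hits _ I Q (env₀ r) n s (h₀.1 r (by simp)) ?_ ?_ ?_ hs
    · exact fun i hi s hs => forAll_inv I (fun env' he => hI env' (he.cons hi)) hs
    · exact fun i hi s hs hq => (forAll_inv (fun s => I s ∧ Q s) (fun env' he s h =>
        ⟨hI env' (he.cons hi) s h.1, hQ env' (he.cons hi) s h.1 h.2⟩) ⟨hs, hq⟩).2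
    · have hi : env₀ r < n := h₀.1 r (by simp)
      exact fun s hs => ih h₀.of_cons (fun env' he => hI env' (he.cons hi))
        (fun env' he => hQ env' (he.cons hi)) hs

theorem Prog.seqAll_inv {ps : List (Prog R X V)} {last : Prog R X V} {env : R → ℕ}
    {s : V × Arrays X} (I : V × Arrays X → Prop)
    (h : ∀ p ∈ ps, ∀ s, I s → I (p.denote n env s)) (hl : ∀ s, I s → I (last.denote n env s))
    (hs : I s) : I ((seqAll ps last).denote n env s) := by
  induction ps generalizing s with
  | nil => exact hl s hs
  | cons p ps ih => exact ih (fun q hq => h q (by simp [hq])) (h p (by simp) s hs)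

theorem Prog.seqAll_hits {ps : List (Prog R X V)} {last : Prog R X V} {env : R → ℕ}
    {s : V × Arrays X} (I Q : V × Arrays X → Prop) {p₀ : Prog R X V} (h₀ : p₀ ∈ ps)
    (hI : ∀ p ∈ ps, ∀ s, I s → I (p.denote n env s)) (hQ : ∀ p ∈ ps, ∀ s, I s → Q s →
      Q (p.denote n env s)) (hlI : ∀ s, I s → I (last.denote n env s))
    (hlQ : ∀ s, I s → Q s → Q (last.denote n env s))
    (hp : ∀ s, I s → Q (p₀.denote n env s)) (hs : I s) :
    Q ((seqAll ps last).denote n env s) := by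
  induction ps generalizing s with
  | nil => simp at h₀
  | cons p ps ih =>
    rcases List.mem_cons.1 h₀ with rfl | h₀
    · exact (seqAll_inv (ps := ps) (fun s => I s ∧ Q s)
        (fun q hq s h => ⟨hI q (by simp [hq]) s h.1, hQ q (by simp [hq]) s h.1 h.2⟩)
        (fun s h => ⟨hlI s h.1, hlQ s h.1 h.2⟩) ⟨hI _ (by simp) s hs, hp s hs⟩).2
    · exact ih h₀ (fun q hq => hI q (by simp [hq])) (fun q hq => hQ q (by simp [hq]))
        (hI p (by simp) s hs)

end Loops

section Guards

variable {R X : Type} [DecidableEq R]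

/-- Records in the variable `ok` whether a condition holds. -/
def Prog.test (c : Cond R X) : Prog R X Vars :=
  .rw c.x c.i c.j (fun v b => { v with ok := v.ok && b == c.b }) (fun _ b => b)

/-- Evaluates the conjunction of some conditions before running `last`. -/
def Prog.guarded (cs : List (Cond R X)) (last : Prog R X Vars) : Prog R X Vars :=
  seqAll (cs.map test) last

/-- Writes `b` to a cell if the conditions `cs` hold. -/
def Prog.guardedWrite (cs : List (Cond R X)) (x : X) (i j : R) (b : Bool) : Prog R X Vars :=
  guarded cs (.rw x i j (fun v _ => { v with ok := true }) (fun v c => if v.ok then b else c))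

theorem Prog.guarded_wellFormed {n : ℕ} {cs : List (Cond R X)} {last : Prog R X Vars} {env : R → ℕ}
    (h : ∀ c ∈ cs, env c.i < n ∧ env c.j < n) (hl : last.WellFormed n env) :
    (guarded cs last).WellFormed n env := by
  refine seqAll_wellFormed (fun p hp => ?_) hl
  obtain ⟨c, hc, rfl⟩ := List.mem_map.1 hp
  exact h c hc

variable [DecidableEq X]

theorem Arrays.write_self (a : Arrays X) (x : X) (i j : ℕ) : a.write x i j (a x i j) = a := by
  funext y k l
  simp only [Arrays.write]
  split_ifs with h
  · rw [h.1, h.2.1, h.2.2]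
  · rfl

open scoped Classical in
theorem Prog.denote_guarded (n : ℕ) (cs : List (Cond R X)) (last : Prog R X Vars) (env : R → ℕ)
    (v : Vars) (a : Arrays X) : (guarded cs last).denote n env (v, a) =
      last.denote n env ({ v with ok := v.ok && decide (∀ c ∈ cs, c.Holds env a) }, a) := by
  induction cs generalizing v with
  | nil => simp [guarded, seqAll]
  | cons c cs ih =>
    have h : (guarded (c :: cs) last).denote n env (v, a) =
        (guarded cs last).denote n env ((test c).denote n env (v, a)) := rfl
    rw [h, test, denote, Arrays.write_self, ih]
    congr 3
    rw [Bool.eq_iff_iff]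
    simp only [Bool.and_eq_true, beq_iff_eq, decide_eq_true_eq, List.forall_mem_cons, and_assoc]
    exact Iff.rfl

open scoped Classical in
theorem Prog.denote_guardedWrite (n : ℕ) (cs : List (Cond R X)) (x : X) (i j : R) (b : Bool)
    (env : R → ℕ) (v : Vars) (hv : v.ok = true) (a : Arrays X) :
    (guardedWrite cs x i j b).denote n env (v, a) =
      (v, if ∀ c ∈ cs, c.Holds env a then a.write x (env i) (env j) b else a) := by
  rw [guardedWrite, denote_guarded, denote]
  refine Prod.ext (by cases v; simp_all) ?_
  by_cases h : ∀ c ∈ cs, c.Holds env a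
  · rw [if_pos h]
    simp only [decide_eq_true h, hv, Bool.and_self, if_true]
  · rw [if_neg h]
    simp only [decide_eq_false h, Bool.and_false, Bool.false_eq_true, if_false, Arrays.write_self]

end Guards

end PathArrowing

/-! ### A program for implications in a 2-CNF -/

namespace PathArrowing

open Function

/-- The input matrices among the arrays. -/
def Arrays.base (a : Arrays Arr) : Arrays Base := fun x => a (.base x)

/-- The literals found so far. -/
def Arrays.marked (n : ℕ) (a : Arrays Arr) : Set (Literal (ℕ × ℕ)) :=
  {l | l.1.1 < n ∧ l.1.2 < n ∧ a (.lit l.2) l.1.1 l.1.2 = true}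

/-- A condition of a template as a condition on the arrays and registers of the program. -/
def Cond.lift (c : Cond (Fin 5) Base) : Cond Reg Arr := ⟨.base c.x, .var c.i, .var c.j, c.b⟩

/-- The registers for the variables of a template. -/
def varRegs : List Reg := [.var 0, .var 1, .var 2, .var 3, .var 4]

theorem mem_varRegs (r : Reg) : r ∈ varRegs ↔ ∃ i, r = .var i := by
  constructor
  · intro h
    simp only [varRegs, List.mem_cons, List.not_mem_nil, or_false] at h
    rcases h with h | h | h | h | h <;> exact ⟨_, h⟩
  · rintro ⟨i, rfl⟩
    fin_cases i <;> simp [varRegs]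

/-- Applies an instance of an implication. -/
def ruleProg (r : Rule) : Prog Reg Arr Vars :=
  .guardedWrite (r.conds.map Cond.lift ++ [⟨.lit r.l.2, .var r.l.1.1, .var r.l.1.2, true⟩])
    (.lit r.m.2) (.var r.m.1.1) (.var r.m.1.2) true

/-- A program without effect. -/
def nopProg : Prog Reg Arr Vars :=
  .rw (.base .adj) (.var 0) (.var 0) (fun v _ => v) (fun _ b => b)

theorem denote_nopProg (n : ℕ) (env : Reg → ℕ) (s : Vars × Arrays Arr) :
    nopProg.denote n env s = s :=
  Prod.ext rfl (Arrays.write_self _ _ _ _)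

/-- Applies all instances of all implications once. -/
def roundProg (Φ : List Clause) : Prog Reg Arr Vars :=
  .forAll varRegs (.seqAll ((Φ.flatMap Clause.rules).map ruleProg) nopProg)

theorem marked_write_true (n : ℕ) (a : Arrays Arr) (l : Literal (ℕ × ℕ)) (h₁ : l.1.1 < n)
    (h₂ : l.1.2 < n) :
    (a.write (.lit l.2) l.1.1 l.1.2 true).marked n = insert l (a.marked n) := by
  ext m
  simp only [Arrays.marked, Arrays.write, Set.mem_ofPred_eq, Set.mem_insert_iff, Arr.lit.injEq]
  by_cases h : m = l
  · subst h; simp [h₁, h₂]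
  · have : ¬ (m.2 = l.2 ∧ m.1.1 = l.1.1 ∧ m.1.2 = l.1.2) := by
      rintro ⟨h1, h2, h3⟩
      exact h (Prod.ext (Prod.ext h2 h3) h1)
    simp [h, this]

theorem denote_ruleProg {n : ℕ} (r : Rule) {env : Reg → ℕ} (henv : ∀ i, env (.var i) < n)
    (s : Vars × Arrays Arr) (hs : s.1.ok = true) :
    ((ruleProg r).denote n env s).1 = s.1 ∧
    ((ruleProg r).denote n env s).2.base = s.2.base ∧
    ((((∀ q ∈ r.conds, q.Holds (fun i => env (.var i)) s.2.base) ∧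
        instLit (fun i => env (.var i)) r.l ∈ s.2.marked n) ∧
      ((ruleProg r).denote n env s).2.marked n =
        insert (instLit (fun i => env (.var i)) r.m) (s.2.marked n)) ∨
    (¬ ((∀ q ∈ r.conds, q.Holds (fun i => env (.var i)) s.2.base) ∧
        instLit (fun i => env (.var i)) r.l ∈ s.2.marked n) ∧
      ((ruleProg r).denote n env s).2.marked n = s.2.marked n)) := by
  obtain ⟨v, a⟩ := s
  have hiff : (∀ c ∈ r.conds.map Cond.lift ++
      [⟨.lit r.l.2, .var r.l.1.1, .var r.l.1.2, true⟩], c.Holds env a) ↔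
      ((∀ q ∈ r.conds, q.Holds (fun i => env (.var i)) a.base) ∧
        instLit (fun i => env (.var i)) r.l ∈ a.marked n) := by
    simp only [List.mem_append, List.mem_map, List.mem_singleton, or_imp, forall_and,
      forall_exists_index, and_imp, forall_apply_eq_imp_iff₂, forall_eq]
    refine and_congr Iff.rfl ?_
    simp [Cond.Holds, Arrays.marked, instLit, henv]
  rw [ruleProg, Prog.denote_guardedWrite n _ _ _ _ _ _ _ hs]
  by_cases h : (∀ q ∈ r.conds, q.Holds (fun i => env (.var i)) a.base) ∧
        instLit (fun i => env (.var i)) r.l ∈ a.marked n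
  · rw [if_pos (hiff.2 h)]
    refine ⟨rfl, ?_, Or.inl ⟨h, ?_⟩⟩
    · funext x i j
      simp [Arrays.base, Arrays.write]
    · exact marked_write_true n a (instLit (fun i => env (.var i)) r.m) (henv _) (henv _)
  · rw [if_neg fun h' => h (hiff.1 h')]
    exact ⟨rfl, rfl, Or.inr ⟨h, rfl⟩⟩

theorem IsExt.var_lt {n : ℕ} {env env' : Reg → ℕ} (h : IsExt n varRegs env env') (i : Fin 5) :
    env' (.var i) < n :=
  h.1 _ ((mem_varRegs _).2 ⟨i, rfl⟩)

/-- One round keeps the variables and the input matrices, marks only literals in any set `P` that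
contains the marked ones and is closed under implication, and marks everything that is implied in
one step by a marked literal. -/
theorem denote_roundProg {n : ℕ} (Φ : List Clause) (env : Reg → ℕ) (s : Vars × Arrays Arr)
    (hs : s.1.ok = true) {P : Set (Literal (ℕ × ℕ))} (hsP : s.2.marked n ⊆ P)
    (hP : ∀ l m, l ∈ P → Implies (Clauses n s.2.base Φ) l m → m ∈ P) :
    ((roundProg Φ).denote n env s).1 = s.1 ∧
    ((roundProg Φ).denote n env s).2.base = s.2.base ∧
    s.2.marked n ⊆ ((roundProg Φ).denote n env s).2.marked n ∧
    ((roundProg Φ).denote n env s).2.marked n ⊆ P ∧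
    ∀ l m, l ∈ s.2.marked n → Implies (Clauses n s.2.base Φ) l m →
      m ∈ ((roundProg Φ).denote n env s).2.marked n := by
  let I : Vars × Arrays Arr → Prop := fun t =>
    t.1 = s.1 ∧ t.2.base = s.2.base ∧ s.2.marked n ⊆ t.2.marked n ∧ t.2.marked n ⊆ P
  have hrule : ∀ env', IsExt n varRegs env env' → ∀ p ∈ (Φ.flatMap Clause.rules).map ruleProg,
      ∀ t, I t → I (p.denote n env' t) ∧ t.2.marked n ⊆ (p.denote n env' t).2.marked n := by
    rintro env' he p hp t ⟨h1, h2, h3, h4⟩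
    obtain ⟨r, hr, rfl⟩ := List.mem_map.1 hp
    obtain ⟨e1, e2, ⟨⟨hc, hl⟩, e3⟩ | ⟨-, e3⟩⟩ :=
      denote_ruleProg r he.var_lt t (by rw [h1]; exact hs)
    · refine ⟨⟨e1.trans h1, e2.trans h2, ?_, ?_⟩, ?_⟩
      · rw [e3]; exact h3.trans (Set.subset_insert _ _)
      · rw [e3]
        refine Set.insert_subset (hP _ _ (h4 hl) ?_) h4
        rw [implies_clauses_iff]
        exact ⟨r, hr, _, he.var_lt, by rwa [← h2], rfl, rfl⟩
      · rw [e3]; exact Set.subset_insert _ _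
    · exact ⟨⟨e1.trans h1, e2.trans h2, by rwa [e3], by rwa [e3]⟩, by rw [e3]⟩
  have hbody : ∀ env', IsExt n varRegs env env' → ∀ t, I t →
      I ((Prog.seqAll ((Φ.flatMap Clause.rules).map ruleProg) nopProg).denote n env' t) :=
    fun env' he t ht => Prog.seqAll_inv I (fun p hp t ht => (hrule env' he p hp t ht).1)
      (fun t ht => by rwa [denote_nopProg]) ht
  have h0 : I s := ⟨rfl, rfl, subset_rfl, hsP⟩
  obtain ⟨g1, g2, g3, g4⟩ := Prog.forAll_inv I hbody h0
  refine ⟨g1, g2, g3, g4, fun l m hl hlm => ?_⟩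
  rw [implies_clauses_iff] at hlm
  obtain ⟨r, hr, ρ, hρ, hq, rfl, rfl⟩ := hlm
  let env₀ : Reg → ℕ := fun
    | .var i => ρ i
    | z => env z
  have h₀ : IsExt n varRegs env env₀ := by
    refine ⟨fun z hz => ?_, fun z hz => ?_⟩
    · obtain ⟨i, rfl⟩ := (mem_varRegs z).1 hz
      exact hρ i
    · cases z with
      | var i => exact absurd ((mem_varRegs _).2 ⟨i, rfl⟩) hz
      | _ => rfl
  have hQ : ∀ env', IsExt n varRegs env env' → ∀ t, I t → instLit ρ r.m ∈ t.2.marked n →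
      instLit ρ r.m ∈ ((Prog.seqAll ((Φ.flatMap Clause.rules).map ruleProg) nopProg).denote n
        env' t).2.marked n := fun env' he t ht hm =>
    (Prog.seqAll_inv (fun t => I t ∧ instLit ρ r.m ∈ t.2.marked n)
      (fun p hp t ht => ⟨(hrule env' he p hp t ht.1).1, (hrule env' he p hp t ht.1).2 ht.2⟩)
      (fun t ht => by rwa [denote_nopProg]) ⟨ht, hm⟩).2
  refine Prog.forAll_hits I (fun t => instLit ρ r.m ∈ t.2.marked n) h₀ hbody hQ (fun t ht => ?_) h0
  refine Prog.seqAll_hits I (fun t => instLit ρ r.m ∈ t.2.marked n)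
    (p₀ := ruleProg r) (List.mem_map.2 ⟨r, hr, rfl⟩) (fun p hp t ht => (hrule env₀ h₀ p hp t ht).1)
    (fun p hp t ht hm => (hrule env₀ h₀ p hp t ht).2 hm) (fun t ht => by rwa [denote_nopProg])
    (fun t _ hm => by rwa [denote_nopProg]) (fun t ht => ?_) ht
  obtain ⟨h1, h2, h3, h4⟩ := ht
  obtain ⟨-, -, ⟨-, e3⟩ | ⟨hn, -⟩⟩ := denote_ruleProg r h₀.var_lt t (by rw [h1]; exact hs)
  · rw [e3]; exact Set.mem_insert _ _
  · exact absurd ⟨by rwa [h2], h3 hl⟩ hn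

/-- Repeats the rounds `2 n ^ 2` times. -/
def closureProg (Φ : List Clause) : Prog Reg Arr Vars :=
  .forEach .it₁ (.forEach .it₂ (.seq (roundProg Φ) (roundProg Φ)))

theorem marked_subset (n : ℕ) (a : Arrays Arr) : a.marked n ⊆
    (((Finset.range n ×ˢ Finset.range n) ×ˢ Finset.univ : Finset (Literal (ℕ × ℕ))) :
      Set (Literal (ℕ × ℕ))) := by
  intro l hl
  simp [hl.1, hl.2.1]

theorem finite_marked (n : ℕ) (a : Arrays Arr) : (a.marked n).Finite :=
  (Finset.finite_toSet _).subset (marked_subset n a)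

/-- After `2 n ^ 2` rounds, started from a single literal, the marked literals are those that this
literal implies: as long as this is not so, each round marks a new one. -/
theorem denote_closureProg {n : ℕ} (Φ : List Clause) (env : Reg → ℕ) (s : Vars × Arrays Arr)
    (hs : s.1.ok = true) (l₀ : Literal (ℕ × ℕ)) (hl₀ : s.2.marked n = {l₀}) :
    ((closureProg Φ).denote n env s).1 = s.1 ∧
    ((closureProg Φ).denote n env s).2.base = s.2.base ∧
    ((closureProg Φ).denote n env s).2.marked n =
      {l | ImpliesStar (Clauses n s.2.base Φ) l₀ l} := by
  set P : Set (Literal (ℕ × ℕ)) := {l | ImpliesStar (Clauses n s.2.base Φ) l₀ l} with hPdef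
  have hP : ∀ l m, l ∈ P → Implies (Clauses n s.2.base Φ) l m → m ∈ P := fun l m hl hlm =>
    Relation.ReflTransGen.tail hl hlm
  let I : ℕ → Vars × Arrays Arr → Prop := fun k t =>
    t.1 = s.1 ∧ t.2.base = s.2.base ∧ l₀ ∈ t.2.marked n ∧ t.2.marked n ⊆ P ∧
      (t.2.marked n = P ∨ k ≤ (t.2.marked n).ncard)
  have hround : ∀ env' k t, I k t → I (k + 1) ((roundProg Φ).denote n env' t) := by
    rintro env' k t ⟨h1, h2, h3, h4, h5⟩
    obtain ⟨g1, g2, g3, g4, g5⟩ := denote_roundProg Φ env' t (by rw [h1]; exact hs) h4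
      (by rwa [h2])
    refine ⟨g1.trans h1, g2.trans h2, g3 h3, g4, ?_⟩
    by_cases heq : t.2.marked n = ((roundProg Φ).denote n env' t).2.marked n
    · refine Or.inl (g4.antisymm fun l hl => ?_)
      induction hl with
      | refl => exact g3 h3
      | tail _ hlm ih => exact g5 _ _ (heq ▸ ih) (h2 ▸ hlm)
    · rcases h5 with h5 | h5
      · exact Or.inl (g4.antisymm (h5 ▸ g3))
      · have := Set.ncard_lt_ncard (lt_of_le_of_ne g3 heq) (finite_marked _ _)
        exact Or.inr (by omega)
  have h0 : I 0 s := ⟨rfl, rfl, by rw [hl₀]; rfl, by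
    rw [hl₀]; exact Set.singleton_subset_iff.2 .refl, Or.inr (Nat.zero_le _)⟩
  obtain ⟨h1, h2, -, h4, h5⟩ := iterDown_counted _ I (n * 2) n 0 s
    (fun i _ k t ht => iterDown_counted _ I 2 n k t
      (fun j _ k t ht => hround _ _ _ (hround _ _ _ ht)) ht) h0
  refine ⟨h1, h2, ?_⟩
  rcases h5 with h5 | h5
  · exact h5
  -- all literals are marked if their number has reached `2 n ^ 2`
  · have hfull := Set.eq_of_subset_of_ncard_le (marked_subset n _) (by
      rw [Set.ncard_coe_finset]
      refine le_trans (le_of_eq ?_) h5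
      simp; ring) (Finset.finite_toSet _)
    refine h4.antisymm fun l hl => ?_
    refine hfull.ge ?_
    have h₀ : l₀.1.1 < n ∧ l₀.1.2 < n := by
      have : l₀ ∈ s.2.marked n := by rw [hl₀]; rfl
      exact ⟨this.1, this.2.1⟩
    rcases Relation.ReflTransGen.cases_tail hl with rfl | ⟨m, -, hlm⟩
    · simp [h₀]
    · obtain ⟨r, -, ρ, hρ, -, -, rfl⟩ := (implies_clauses_iff _ _ _ _ _).1 hlm
      simp [instLit, hρ]

/-- Unmarks the two literals of a pair of vertices. -/
def clearPairProg : Prog Reg Arr Vars :=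
  .seq (.guardedWrite [] (.lit true) (.var 0) (.var 1) false)
    (.guardedWrite [] (.lit false) (.var 0) (.var 1) false)

/-- Unmarks all literals. -/
def clearProg : Prog Reg Arr Vars :=
  .forAll [.var 0, .var 1] clearPairProg

theorem isExt_pair {n i j : ℕ} (hi : i < n) (hj : j < n) (r q : Reg) (env : Reg → ℕ) :
    IsExt n [r, q] env (update (update env r i) q j) := by
  refine ⟨fun z hz => ?_, fun z hz => ?_⟩
  · simp only [List.mem_cons, List.not_mem_nil, or_false] at hz
    by_cases h : z = q
    · subst h; simpa
    · rw [update_of_ne h, hz.resolve_right h, update_self]; exact hi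
  · simp only [List.mem_cons, List.not_mem_nil, or_false, not_or] at hz
    rw [update_of_ne hz.2, update_of_ne hz.1]

theorem denote_clearProg {n : ℕ} (env : Reg → ℕ) (s : Vars × Arrays Arr) (hs : s.1.ok = true) :
    (clearProg.denote n env s).1 = s.1 ∧ (clearProg.denote n env s).2.base = s.2.base ∧
      (clearProg.denote n env s).2.marked n = ∅ := by
  let I : Vars × Arrays Arr → Prop := fun t => t.1 = s.1 ∧ t.2.base = s.2.base
  have hbody : ∀ env' (t : Vars × Arrays Arr), I t →
      clearPairProg.denote n env' t =
      (t.1, (t.2.write (.lit true) (env' (.var 0)) (env' (.var 1)) false).write (.lit false)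
        (env' (.var 0)) (env' (.var 1)) false) := by
    rintro env' ⟨v, a⟩ ⟨h1, -⟩
    have hv : v.ok = true := by rw [show v = s.1 from h1]; exact hs
    rw [clearPairProg, Prog.denote, Prog.denote_guardedWrite n _ _ _ _ _ _ _ hv,
      Prog.denote_guardedWrite n _ _ _ _ _ _ _ hv]
    simp
  have hI : ∀ env', IsExt n [.var 0, .var 1] env env' → ∀ t, I t →
      I (clearPairProg.denote n env' t) := by
    intro env' _ t ht
    rw [hbody env' t ht]
    refine ⟨ht.1, ht.2 ▸ ?_⟩
    funext x i j
    simp [Arrays.base, Arrays.write]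
  obtain ⟨h1, h2⟩ := Prog.forAll_inv (s := s) I hI ⟨rfl, rfl⟩
  refine ⟨h1, h2, Set.eq_empty_iff_forall_notMem.2 ?_⟩
  rintro ⟨⟨i, j⟩, b⟩ ⟨hi, hj, hb⟩
  have := Prog.forAll_hits (s := s) I (fun t => t.2 (.lit b) i j = false)
    (isExt_pair hi hj (.var 0) (.var 1) env) hI
    (fun env' _ t ht hQ => by
      rw [hbody env' t ht]
      simp [Arrays.write, hQ])
    (fun t ht => by
      rw [hbody _ t ht]
      cases b <;> simp [Arrays.write]) ⟨rfl, rfl⟩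
  rw [clearProg, this] at hb
  exact Bool.false_ne_true hb

/-- Marks the literals implied by the literal given by the start registers and `b`. -/
def searchProg (Φ : List Clause) (b : Bool) : Prog Reg Arr Vars :=
  .seq clearProg (.seq (.guardedWrite [] (.lit b) .src .tgt true) (closureProg Φ))

theorem denote_searchProg {n : ℕ} (Φ : List Clause) (b : Bool) (env : Reg → ℕ)
    (hsrc : env .src < n) (htgt : env .tgt < n) (s : Vars × Arrays Arr) (hs : s.1.ok = true) :
    ((searchProg Φ b).denote n env s).1 = s.1 ∧
    ((searchProg Φ b).denote n env s).2.base = s.2.base ∧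
    ((searchProg Φ b).denote n env s).2.marked n =
      {l | ImpliesStar (Clauses n s.2.base Φ) ((env .src, env .tgt), b) l} := by
  obtain ⟨h1, h2, h3⟩ := denote_clearProg (n := n) env s hs
  rw [searchProg, Prog.denote, Prog.denote]
  generalize clearProg.denote n env s = t at h1 h2 h3 ⊢
  obtain ⟨v, a⟩ := t
  simp only at h1 h2 h3
  subst h1
  rw [Prog.denote_guardedWrite n _ _ _ _ _ _ _ hs]
  simp only [List.not_mem_nil, false_imp_iff, implies_true, if_true]
  have h4 : (a.write (.lit b) (env .src) (env .tgt) true).base = s.2.base := by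
    rw [← h2]
    funext x i j
    simp [Arrays.base, Arrays.write]
  have h5 := marked_write_true n a ((env .src, env .tgt), b) hsrc htgt
  rw [h3, insert_empty_eq] at h5
  obtain ⟨g1, g2, g3⟩ := denote_closureProg Φ env
    (s.1, a.write (.lit b) (env .src) (env .tgt) true) hs _ h5
  exact ⟨g1, g2.trans h4, by rw [g3, h4]⟩

/-- Checks whether the two literals of a pair of vertices imply each other. -/
def checkPairProg (Φ : List Clause) : Prog Reg Arr Vars :=
  .seq (searchProg Φ true) <|
  .seq (.rw (.lit false) .src .tgt (fun v b => { v with first := b }) (fun _ b => b)) <|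
  .seq (searchProg Φ false)
    (.rw (.lit true) .src .tgt (fun v b => { v with ans := v.ans || (v.first && b) })
      (fun _ b => b))

/-- Looks for a pair of vertices whose two literals imply each other. -/
def mainProg (Φ : List Clause) : Prog Reg Arr Vars :=
  .forAll [.src, .tgt] (checkPairProg Φ)

theorem denote_mainProg {n : ℕ} (Φ : List Clause) (env : Reg → ℕ) (s : Vars × Arrays Arr)
    (hs : s.1.ok = true) (hans : s.1.ans = false) :
    ((mainProg Φ).denote n env s).1.seen = s.1.seen ∧
    ((mainProg Φ).denote n env s).1.valid = s.1.valid ∧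
    (((mainProg Φ).denote n env s).1.ans = true ↔ ∃ i < n, ∃ j < n,
      ImpliesStar (Clauses n s.2.base Φ) ((i, j), true) ((i, j), false) ∧
      ImpliesStar (Clauses n s.2.base Φ) ((i, j), false) ((i, j), true)) := by
  set C := Clauses n s.2.base Φ with hC
  let bad : ℕ → ℕ → Prop := fun i j =>
    ImpliesStar C ((i, j), true) ((i, j), false) ∧ ImpliesStar C ((i, j), false) ((i, j), true)
  let I : Vars × Arrays Arr → Prop := fun t =>
    t.1.seen = s.1.seen ∧ t.1.valid = s.1.valid ∧ t.1.ok = true ∧ t.2.base = s.2.base ∧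
      (t.1.ans = true → ∃ i < n, ∃ j < n, bad i j)
  have hbody : ∀ env', IsExt n [.src, .tgt] env env' → ∀ t, I t →
      I ((checkPairProg Φ).denote n env' t) ∧ (((checkPairProg Φ).denote n env' t).1.ans = true ↔
        t.1.ans = true ∨ bad (env' .src) (env' .tgt)) := by
    rintro env' he t ⟨h1, h2, h3, h4, h5⟩
    have hi : env' .src < n := he.1 _ (by simp)
    have hj : env' .tgt < n := he.1 _ (by simp)
    obtain ⟨a1, a2, a3⟩ := denote_searchProg Φ true env' hi hj t h3
    simp only [checkPairProg, Prog.denote]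
    generalize (searchProg Φ true).denote n env' t = t₁ at a1 a2 a3 ⊢
    rw [Arrays.write_self]
    obtain ⟨b1, b2, b3⟩ := denote_searchProg Φ false env' hi hj
      ({ t₁.1 with first := t₁.2 (.lit false) (env' .src) (env' .tgt) }, t₁.2) (by rw [← h3, a1])
    generalize (searchProg Φ false).denote n env' _ = t₂ at b1 b2 b3 ⊢
    have m1 : t₁.2 (.lit false) (env' .src) (env' .tgt) = true ↔
        ImpliesStar C ((env' .src, env' .tgt), true) ((env' .src, env' .tgt), false) := by
      have : ((env' .src, env' .tgt), false) ∈ t₁.2.marked n ↔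
        t₁.2 (.lit false) (env' .src) (env' .tgt) = true := by simp [Arrays.marked, hi, hj]
      rw [← this, a3, h4]; rfl
    have m2 : t₂.2 (.lit true) (env' .src) (env' .tgt) = true ↔
        ImpliesStar C ((env' .src, env' .tgt), false) ((env' .src, env' .tgt), true) := by
      have : ((env' .src, env' .tgt), true) ∈ t₂.2.marked n ↔
        t₂.2 (.lit true) (env' .src) (env' .tgt) = true := by simp [Arrays.marked, hi, hj]
      rw [← this, b3]
      simp only
      rw [a2, h4]; rfl
    have hfin : (t₂.1.ans || (t₂.1.first && t₂.2 (.lit true) (env' .src) (env' .tgt))) = true ↔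
        t.1.ans = true ∨ bad (env' .src) (env' .tgt) := by
      rw [Bool.or_eq_true, Bool.and_eq_true, m2, b1]
      simp only
      rw [m1, a1]
    rw [Arrays.write_self]
    refine ⟨⟨?_, ?_, ?_, ?_, fun h => ?_⟩, hfin⟩
    · rw [b1, ← h1, ← a1]
    · rw [b1, ← h2, ← a1]
    · rw [b1, ← h3, ← a1]
    · exact b2.trans (a2.trans h4)
    · rcases hfin.1 h with h | h
      · exact h5 h
      · exact ⟨_, hi, _, hj, h⟩
  have h0 : I s := ⟨rfl, rfl, hs, rfl, by simp [hans]⟩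
  obtain ⟨g1, g2, g3, g4, g5⟩ := Prog.forAll_inv (s := s) I
    (fun env' he t ht => (hbody env' he t ht).1) h0
  refine ⟨g1, g2, g5, ?_⟩
  rintro ⟨i, hi, j, hj, hij⟩
  exact Prog.forAll_hits (s := s) I (fun t => t.1.ans = true) (isExt_pair hi hj .src .tgt env)
    (fun env' he t ht => (hbody env' he t ht).1)
    (fun env' he t ht h => (hbody env' he t ht).2.2 (Or.inl h))
    (fun t ht => (hbody _ (isExt_pair hi hj .src .tgt env) t ht).2.2
      (Or.inr (by simpa using hij))) h0

end PathArrowing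

/-! ### Deciding the unsatisfiability of a 2-CNF on a graph -/

namespace PathArrowing

open Function SimpleGraph

/-- Marks the input as invalid if the conditions `cs` hold. -/
def invalidIfProg (cs : List (Cond Reg Arr)) : Prog Reg Arr Vars :=
  .guarded cs (.rw (.base .adj) (.var 0) (.var 0)
    (fun v _ => { v with ok := true, valid := v.valid && !v.ok }) (fun _ b => b))

open scoped Classical in
theorem denote_invalidIfProg (n : ℕ) (cs : List (Cond Reg Arr)) (env : Reg → ℕ)
    (s : Vars × Arrays Arr) (hs : s.1.ok = true) : (invalidIfProg cs).denote n env s =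
      ({ s.1 with valid := s.1.valid && !decide (∀ c ∈ cs, c.Holds env s.2) }, s.2) := by
  obtain ⟨v, a⟩ := s
  simp only at hs
  rw [invalidIfProg, Prog.denote_guarded, Prog.denote]
  simp only [hs, Bool.true_and, Arrays.write_self]

/-- Checks one pair of vertices for symmetry and irreflexivity of the adjacency matrix. -/
def checkEntryProg : Prog Reg Arr Vars :=
  .seq (invalidIfProg [⟨.base .adj, .var 0, .var 1, true⟩, ⟨.base .adj, .var 1, .var 0, false⟩])
    (invalidIfProg [⟨.base .adj, .var 0, .var 0, true⟩])

/-- Checks that the adjacency matrix is symmetric and irreflexive. -/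
def checkProg : Prog Reg Arr Vars :=
  .forAll [.var 0, .var 1] checkEntryProg

/-- The relation is symmetric and irreflexive on `0, …, n - 1`. -/
def IsGraphMatrix (n : ℕ) (A : ℕ → ℕ → Bool) : Prop :=
  ∀ i < n, ∀ j < n, (A i j = true → A j i = true) ∧ A i i = false

theorem denote_checkProg {n : ℕ} (env : Reg → ℕ) (s : Vars × Arrays Arr) (hs : s.1.ok = true) :
    (checkProg.denote n env s).2 = s.2 ∧
    (checkProg.denote n env s).1 =
      { s.1 with valid := (checkProg.denote n env s).1.valid } ∧
    ((checkProg.denote n env s).1.valid = true ↔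
      s.1.valid = true ∧ IsGraphMatrix n (s.2 (.base .adj))) := by
  classical
  set A := s.2 (.base .adj) with hA
  let I : Vars × Arrays Arr → Prop := fun t =>
    t.2 = s.2 ∧ t.1 = { s.1 with valid := t.1.valid } ∧ (t.1.valid = true → s.1.valid = true) ∧
      (IsGraphMatrix n A → t.1.valid = s.1.valid)
  let good : ℕ → ℕ → Bool := fun i j => !(A i j && !A j i) && !A i i
  have hgood : ∀ i j, good i j = true ↔ (A i j = true → A j i = true) ∧ A i i = false := by
    intro i j
    simp only [good]
    cases A i j <;> cases A j i <;> simp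
  have hbody : ∀ env' t, I t → checkEntryProg.denote n env' t =
      ({ t.1 with valid := t.1.valid && good (env' (.var 0)) (env' (.var 1)) }, t.2) := by
    rintro env' t ⟨h1, h2, -⟩
    have hok : t.1.ok = true := by rw [h2]; exact hs
    rw [checkEntryProg, Prog.denote, denote_invalidIfProg n _ _ _ hok]
    refine (denote_invalidIfProg n _ env' _ ?_).trans (Prod.ext ?_ rfl)
    · exact hok
    simp only [Cond.Holds, h1, good, hA, List.forall_mem_cons, List.not_mem_nil, false_imp_iff,
      implies_true, and_true, Vars.mk.injEq, true_and]
    cases s.2 (.base .adj) (env' (.var 0)) (env' (.var 1)) <;>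
      cases s.2 (.base .adj) (env' (.var 1)) (env' (.var 0)) <;> simp
  have hI : ∀ env', IsExt n [.var 0, .var 1] env env' → ∀ t, I t →
      I (checkEntryProg.denote n env' t) := by
    intro env' he t ht
    have hi : env' (.var 0) < n := he.1 _ (by simp)
    have hj : env' (.var 1) < n := he.1 _ (by simp)
    rw [hbody env' t ht]
    obtain ⟨h1, h2, h3, h4⟩ := ht
    refine ⟨h1, ?_, fun h => ?_, fun h => ?_⟩
    · rw [h2]
    · simp only [Bool.and_eq_true] at h
      exact h3 h.1
    · simp [(hgood _ _).2 (h _ hi _ hj), h4 h]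
  have h0 : I s := ⟨rfl, rfl, id, fun _ => rfl⟩
  obtain ⟨g1, g2, g3, g4⟩ := Prog.forAll_inv (s := s) I hI h0
  refine ⟨g1, g2, fun h => ⟨g3 h, fun i hi j hj => ?_⟩, fun h => (g4 h.2).trans h.1⟩
  by_contra hn
  have := Prog.forAll_hits (s := s) I (fun t => t.1.valid = false)
    (isExt_pair hi hj (.var 0) (.var 1) env) hI
    (fun env' _ t ht hQ => by rw [hbody env' t ht]; simp [hQ])
    (fun t ht => by
      rw [hbody _ t ht]
      have e : good i j = false := by rw [← Bool.not_eq_true, hgood]; exact hn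
      simp [e]) h0
  have h' : (checkProg.denote n env s).1.valid = false := this
  rw [h'] at h
  exact Bool.false_ne_true h

/-- Sets one entry on the diagonal of the equality matrix. -/
def diagEntryProg : Prog Reg Arr Vars :=
  .guardedWrite [] (.base .eq) (.var 0) (.var 0) true

/-- Fills the equality matrix. -/
def diagProg : Prog Reg Arr Vars :=
  .forAll [.var 0] diagEntryProg

theorem denote_diagProg {n : ℕ} (env : Reg → ℕ) (s : Vars × Arrays Arr) (hs : s.1.ok = true)
    (heq : ∀ i j, s.2 (.base .eq) i j = false) :
    (diagProg.denote n env s).1 = s.1 ∧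
    (diagProg.denote n env s).2 (.base .adj) = s.2 (.base .adj) ∧
    ∀ i < n, ∀ j < n, ((diagProg.denote n env s).2 (.base .eq) i j = true ↔ i = j) := by
  let I : Vars × Arrays Arr → Prop := fun t =>
    t.1 = s.1 ∧ t.2 (.base .adj) = s.2 (.base .adj) ∧
      ∀ i j, t.2 (.base .eq) i j = true → i = j
  have hbody : ∀ env' t, I t →
      diagEntryProg.denote n env' t =
      (t.1, t.2.write (.base .eq) (env' (.var 0)) (env' (.var 0)) true) := by
    rintro env' ⟨v, a⟩ ⟨h1, -⟩
    have hv : v.ok = true := by rw [show v = s.1 from h1]; exact hs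
    rw [diagEntryProg, Prog.denote_guardedWrite n _ _ _ _ _ _ _ hv]
    simp
  have hI : ∀ env', IsExt n [.var 0] env env' → ∀ t, I t →
      I (diagEntryProg.denote n env' t) := by
    intro env' _ t ht
    rw [hbody env' t ht]
    refine ⟨ht.1, ht.2.1 ▸ ?_, fun i j h => ?_⟩
    · funext i j
      simp [Arrays.write]
    · simp only [Arrays.write, true_and] at h
      split_ifs at h with h'
      · exact h'.1.trans h'.2.symm
      · exact ht.2.2 i j h
  have h0 : I s := ⟨rfl, rfl, fun i j h => by simp [heq] at h⟩
  obtain ⟨g1, g2, g3⟩ := Prog.forAll_inv (s := s) I hI h0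
  refine ⟨g1, g2, fun i hi j _ => ⟨g3 i j, ?_⟩⟩
  rintro rfl
  have h₀ : IsExt n [Reg.var 0] env (update env (.var 0) i) := by
    refine ⟨fun r hr => ?_, fun r hr => ?_⟩
    · rw [List.mem_singleton.1 hr]; simpa
    · rw [update_of_ne (by simpa using hr)]
  exact Prog.forAll_hits (s := s) I (fun t => t.2 (.base .eq) i i = true) h₀ hI
    (fun env' _ t ht hQ => by rw [hbody env' t ht]; simp [Arrays.write, hQ])
    (fun t ht => by rw [hbody _ t ht]; simp [Arrays.write]) h0

/-- Decides whether the input is a graph for which the 2-CNF given by `Φ` is unsatisfiable. -/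
def unsatProg (Φ : List Clause) : Prog Reg Arr Vars :=
  .seq diagProg (.seq checkProg (mainProg Φ))

theorem roundProg_wellFormed {n : ℕ} (Φ : List Clause) {env : Reg → ℕ}
    (h : ∀ i, env (.var i) = n) : (roundProg Φ).WellFormed n env := by
  refine Prog.forAll_wellFormed (by simp [varRegs]) (fun r hr => ?_) fun env' he => ?_
  · obtain ⟨i, rfl⟩ := (mem_varRegs r).1 hr
    exact h i
  · refine Prog.seqAll_wellFormed (fun p hp => ?_) ⟨he.var_lt _, he.var_lt _⟩
    obtain ⟨r, -, rfl⟩ := List.mem_map.1 hp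
    refine Prog.guarded_wellFormed (fun c hc => ?_) ⟨he.var_lt _, he.var_lt _⟩
    rcases List.mem_append.1 hc with hc | hc
    · obtain ⟨q, -, rfl⟩ := List.mem_map.1 hc
      exact ⟨he.var_lt _, he.var_lt _⟩
    · rw [List.mem_singleton.1 hc]
      exact ⟨he.var_lt _, he.var_lt _⟩

theorem searchProg_wellFormed {n : ℕ} (Φ : List Clause) (b : Bool) {env : Reg → ℕ}
    (h : ∀ i, env (.var i) = n) (h₁ : env .it₁ = n) (h₂ : env .it₂ = n) (hs : env .src < n)
    (ht : env .tgt < n) : (searchProg Φ b).WellFormed n env := by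
  refine ⟨Prog.forAll_wellFormed (by simp) (by simp [h]) fun env' he => ?_, ⟨hs, ht⟩,
    h₁, fun i _ => ⟨by simpa, fun j _ => ?_⟩⟩
  · have h0 : env' (.var 0) < n := he.1 _ (by simp)
    have h1 : env' (.var 1) < n := he.1 _ (by simp)
    exact ⟨⟨h0, h1⟩, h0, h1⟩
  · have := roundProg_wellFormed (n := n) Φ (env := update (update env .it₁ i) .it₂ j)
      (by simpa using h)
    exact ⟨this, this⟩

theorem unsatProg_wellFormed (Φ : List Clause) (n : ℕ) :
    (unsatProg Φ).WellFormed n fun _ => n := by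
  refine ⟨Prog.forAll_wellFormed (by simp) (by simp) fun env' he => ?_,
    Prog.forAll_wellFormed (by simp) (by simp) fun env' he => ?_,
    Prog.forAll_wellFormed (by simp) (by simp) fun env' he => ?_⟩
  · have h0 : env' (.var 0) < n := he.1 _ (by simp)
    exact ⟨h0, h0⟩
  · have h0 : env' (.var 0) < n := he.1 _ (by simp)
    have h1 : env' (.var 1) < n := he.1 _ (by simp)
    exact ⟨⟨⟨h0, h1⟩, ⟨h1, h0⟩, h0, h0⟩, ⟨h0, h0⟩, h0, h0⟩
  · have hs : env' .src < n := he.1 _ (by simp)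
    have ht : env' .tgt < n := he.1 _ (by simp)
    have hw := fun b => searchProg_wellFormed (n := n) Φ b (env := env')
      (fun i => he.2 _ (by simp)) (he.2 _ (by simp)) (he.2 _ (by simp)) hs ht
    exact ⟨hw true, ⟨hs, ht⟩, hw false, hs, ht⟩

/-- The program answers whether the input is valid and the 2-CNF is unsatisfiable. -/
theorem denote_unsatProg (Φ : List Clause) (n : ℕ) (seen valid : Bool) (a : Arrays Arr)
    (ha : ∀ i j, a (.base .eq) i j = false) : ∃ M : Arrays Base, M .adj = a (.base .adj) ∧
      (∀ i < n, ∀ j < n, (M .eq i j = true ↔ i = j)) ∧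
      ∀ v, v = ((unsatProg Φ).denote n (fun _ => n) (⟨seen, valid, true, false, false⟩, a)).1 →
        ((v.seen && v.valid && v.ans) = true ↔ seen = true ∧ valid = true ∧
          IsGraphMatrix n (a (.base .adj)) ∧ ¬ Satisfiable (Clauses n M Φ)) := by
  obtain ⟨h1, h2, h3⟩ := denote_diagProg (n := n) (fun _ => n)
    (⟨seen, valid, true, false, false⟩, a) rfl ha
  simp only [unsatProg, Prog.denote]
  generalize diagProg.denote n (fun _ => n) (⟨seen, valid, true, false, false⟩, a) = s₁
    at h1 h2 h3 ⊢
  obtain ⟨g1, g2, g3⟩ := denote_checkProg (n := n) (fun _ => n) s₁ (by rw [h1])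
  generalize checkProg.denote n (fun _ => n) s₁ = s₂ at g1 g2 g3 ⊢
  obtain ⟨k1, k2, k3⟩ := denote_mainProg (n := n) Φ (fun _ => n) s₂ (by rw [g2, h1])
    (by rw [g2, h1])
  refine ⟨s₂.2.base, by rw [g1]; exact h2, by rw [g1]; exact h3, ?_⟩
  rintro v rfl
  rw [Bool.and_eq_true, Bool.and_eq_true, k1, k2, k3, g3, g2, h1, h2, not_satisfiable_iff,
    and_assoc, and_assoc]
  refine and_congr_right fun _ => and_congr_right fun _ => and_congr_right fun _ => ?_
  constructor
  · rintro ⟨i, -, j, -, h⟩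
    exact ⟨(i, j), h⟩
  · rintro ⟨⟨i, j⟩, h⟩
    -- the second literal is implied by another one, so it belongs to an instance of a clause
    obtain ⟨hi, hj⟩ : i < n ∧ j < n := by
      rcases Relation.ReflTransGen.cases_tail h.1 with h | ⟨m, -, hm⟩
      · simp at h
      · obtain ⟨r, -, ρ, hρ, -, -, h⟩ := (implies_clauses_iff _ _ _ _ _).1 hm
        rw [Prod.ext_iff, Prod.ext_iff] at h
        simp only [instLit] at h
        rw [h.1.1, h.1.2]
        exact ⟨hρ _, hρ _⟩
    exact ⟨i, hi, j, hj, h⟩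

end PathArrowing

/-! ### The 2-CNF of a graph and the encoding of graphs -/

namespace PathArrowing

open SimpleGraph

/-- The clauses, over the five vertex variables `0, …, 4`, that express that a set of edges is a
red graph in the sense of `IsRedGraph`; the atom `(i, j)` says that the edge `ij` is red. In the
order of the list: `matching`, the symmetry of the relation, `chord` as a clause with two equal
literals, `pendant` and `branch`. -/
def redClauses : List Clause :=
  let triangle : List (Cond (Fin 5) Base) :=
    [⟨.adj, 0, 1, true⟩, ⟨.adj, 1, 2, true⟩, ⟨.adj, 0, 2, true⟩, ⟨.adj, 2, 3, true⟩,
      ⟨.eq, 3, 0, false⟩, ⟨.eq, 3, 1, false⟩]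
  [⟨[⟨.adj, 0, 1, true⟩, ⟨.adj, 0, 2, true⟩, ⟨.eq, 1, 2, false⟩], ((0, 1), false), ((0, 2), false)⟩,
    ⟨[], ((0, 1), true), ((1, 0), false)⟩,
    ⟨triangle, ((0, 2), false), ((0, 2), false)⟩,
    ⟨triangle, ((0, 1), true), ((2, 3), true)⟩,
    ⟨[⟨.adj, 0, 1, true⟩, ⟨.adj, 1, 2, true⟩, ⟨.eq, 0, 2, false⟩, ⟨.adj, 0, 2, false⟩,
      ⟨.adj, 2, 3, true⟩, ⟨.adj, 2, 4, true⟩, ⟨.eq, 3, 1, false⟩, ⟨.eq, 4, 1, false⟩,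
      ⟨.eq, 3, 4, false⟩], ((0, 1), true), ((1, 2), true)⟩]

theorem satisfiable_clauses_redClauses_iff {n : ℕ} (G : SimpleGraph (Fin n)) (M : Arrays Base)
    (hadj : ∀ i j : Fin n, M .adj i j = true ↔ G.Adj i j)
    (heq : ∀ i < n, ∀ j < n, (M .eq i j = true ↔ i = j)) :
    Satisfiable (Clauses n M redClauses) ↔ ∃ R, IsRedGraph G R := by
  have hadj' : ∀ i j : Fin n, M .adj i j = false ↔ ¬ G.Adj i j := fun i j => by
    rw [← hadj, Bool.not_eq_true]
  have heq' : ∀ i j : Fin n, M .eq i j = false ↔ i ≠ j := fun i j => by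
    rw [← Bool.not_eq_true, heq i i.2 j j.2, Ne, Fin.ext_iff]
  constructor
  · rintro ⟨x, hx⟩
    have key : ∀ c ∈ redClauses, ∀ ρ : Fin 5 → Fin n,
        (∀ q ∈ c.conds, M q.x (ρ q.i) (ρ q.j) = q.b) →
        x (ρ c.l.1.1, ρ c.l.1.2) = c.l.2 ∨ x (ρ c.m.1.1, ρ c.m.1.2) = c.m.2 :=
      fun c hc ρ h => hx _ _ ⟨c, hc, fun i => ρ i, fun i => (ρ i).2, h, rfl, rfl⟩
    simp only [redClauses, List.forall_mem_cons, List.not_mem_nil, false_imp_iff,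
      implies_true, and_true, hadj, hadj', heq', or_self] at key
    obtain ⟨k1, k2, k3, k4, k5⟩ := key
    have hsymm : ∀ a b : Fin n, x (a, b) = true → x (b, a) = true := fun a b h => by
      simpa [h] using k2 ![b, a, a, a, a]
    refine ⟨⟨fun i j => G.Adj i j ∧ x (i, j) = true, ⟨fun i j h => ⟨h.1.symm, hsymm _ _ h.2⟩⟩,
      ⟨fun i h => G.irrefl h.1⟩⟩, fun i j h => h.1, ?_, ?_, ?_, ?_⟩
    · rintro a b c ⟨hab, xab⟩ ⟨hac, xac⟩
      by_contra hbc
      simpa [xab, xac] using k1 ![a, b, c, a, a] ⟨hab, hac, hbc⟩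
    · rintro a b c d hab hbc hac hcd hda hdb ⟨-, xac⟩
      simpa [xac] using k3 ![a, b, c, d, a] ⟨hab, hbc, hac, hcd, hda, hdb⟩
    · intro a b c d hab hbc hac hcd hda hdb
      exact (k4 ![a, b, c, d, a] ⟨hab, hbc, hac, hcd, hda, hdb⟩).imp (⟨hab, ·⟩) (⟨hcd, ·⟩)
    · intro a b c d e hab hbc hac hac' hcd hce hdb heb hde
      exact (k5 ![a, b, c, d, e] ⟨hab, hbc, hac, hac', hcd, hce, hdb, heb, hde⟩).imp
        (⟨hab, ·⟩) (⟨hbc, ·⟩)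
  · rintro ⟨R, hR⟩
    classical
    let x : ℕ × ℕ → Bool := fun p =>
      decide (∃ (h : p.1 < n) (h' : p.2 < n), R.Adj ⟨p.1, h⟩ ⟨p.2, h'⟩)
    have hx : ∀ i j : Fin n, x (i, j) = true ↔ R.Adj i j := fun i j => by simp [x]
    have hx' : ∀ i j : Fin n, x (i, j) = false ↔ ¬ R.Adj i j := fun i j => by
      rw [← hx, Bool.not_eq_true]
    have key : ∀ c ∈ redClauses, ∀ ρ : Fin 5 → Fin n,
        (∀ q ∈ c.conds, M q.x (ρ q.i) (ρ q.j) = q.b) →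
        x (ρ c.l.1.1, ρ c.l.1.2) = c.l.2 ∨ x (ρ c.m.1.1, ρ c.m.1.2) = c.m.2 := by
      simp only [redClauses, List.forall_mem_cons, List.not_mem_nil, false_imp_iff,
        implies_true, and_true, hadj, hadj', heq', hx, hx', or_self]
      refine ⟨fun ρ h => ?_, fun ρ => ?_, fun ρ h => ?_, fun ρ h => ?_, fun ρ h => ?_⟩
      · by_contra! hn
        exact h.2.2 (hR.matching _ _ _ hn.1 hn.2)
      · rw [R.adj_comm (ρ 1)]
        exact fun _ => em _
      · obtain ⟨h1, h2, h3, h4, h5, h6⟩ := h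
        exact hR.chord _ _ _ _ h1 h2 h3 h4 h5 h6
      · obtain ⟨h1, h2, h3, h4, h5, h6⟩ := h
        exact hR.pendant _ _ _ _ h1 h2 h3 h4 h5 h6
      · obtain ⟨h1, h2, h3, h4, h5, h6, h7, h8, h9⟩ := h
        exact hR.branch _ _ _ _ _ h1 h2 h3 h4 h5 h6 h7 h8 h9
    refine ⟨x, ?_⟩
    rintro l m ⟨c, hc, ρ, hρ, h, rfl, rfl⟩
    exact key c hc (fun i => ⟨ρ i, hρ i⟩) h

theorem divNat_modNat_of_index {n : ℕ} (i j : Fin n) (h : i * n + j < n * n) :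
    (⟨i * n + j, h⟩ : Fin (n * n)).divNat = i ∧ (⟨i * n + j, h⟩ : Fin (n * n)).modNat = j := by
  constructor <;> ext
  · rw [Fin.coe_divNat, Fin.val_mk, show (i : ℕ) * n + j = j + n * i by ring,
      Nat.add_mul_div_left _ _ i.pos, Nat.div_eq_of_lt j.2, Nat.zero_add]
  · simp [Fin.modNat, Nat.mod_eq_of_lt j.2]

open scoped Classical in
theorem encodeGraph_eq_append_ofFn {n : ℕ} (G : SimpleGraph (Fin n)) :
    encodeGraph G = List.replicate n true ++ false ::
      List.ofFn fun k : Fin (n * n) => decide (G.Adj k.divNat k.modNat) := by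
  rw [encodeGraph, List.ofFn_mul, List.ofFn_eq_map, List.flatMap_def]
  congr 3
  refine List.map_congr_left fun i _ => ?_
  rw [List.ofFn_eq_map]
  refine List.map_congr_left fun j _ => ?_
  have h := divNat_modNat_of_index i j (index_lt i.2 j.2)
  simp only [h]

/-- The adjacency matrix is stored row by row. -/
theorem encodeGraph_eq_iff {n : ℕ} (G : SimpleGraph (Fin n)) (l : List Bool) :
    encodeGraph G = List.replicate n true ++ false :: l ↔
      l.length = n * n ∧ ∀ i j : Fin n, l.getD (i * n + j) false = true ↔ G.Adj i j := by
  classical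
  rw [encodeGraph_eq_append_ofFn, List.append_cancel_left_eq, List.cons_inj_right]
  constructor
  · rintro rfl
    refine ⟨List.length_ofFn, fun i j => ?_⟩
    have h := index_lt i.2 j.2
    have h' := divNat_modNat_of_index i j h
    rw [List.getD_eq_getElem _ _ (by simpa using h), List.getElem_ofFn]
    simp only [h', decide_eq_true_iff]
  · rintro ⟨h, h'⟩
    refine List.ext_getElem (by simp [h]) fun k hk hk' => ?_
    have hkn : k < n * n := h ▸ hk'
    have e := h' (Fin.divNat ⟨k, hkn⟩) (Fin.modNat ⟨k, hkn⟩)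
    rw [Fin.coe_divNat, Fin.coe_modNat, Nat.div_add_mod', List.getD_eq_getElem _ _ hk'] at e
    rw [List.getElem_ofFn, Bool.eq_iff_iff, e, decide_eq_true_iff]

theorem replicate_append_cons_inj {m n : ℕ} {l l' : List Bool}
    (h : List.replicate m true ++ false :: l = List.replicate n true ++ false :: l') :
    m = n ∧ l = l' := by
  have ht : ∀ (k : ℕ) (t : List Bool),
      (List.replicate k true ++ false :: t).takeWhile id = List.replicate k true := by
    intro k t
    simp
  have hm : m = n := by
    have := congrArg (fun w => (w.takeWhile id).length) h
    simpa only [ht, List.length_replicate] using this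
  subst hm
  simpa using h

theorem inP_arrowingLanguage_pathGraph_three_four :
    InP (arrowingLanguage (pathGraph 3) (pathGraph 4)) := by
  refine inP_of_prog (Arr.base .adj) (.var 0) (unsatProg redClauses)
    (unsatProg_wellFormed redClauses) _ fun n seen rest hseen v hv => ?_
  obtain ⟨M, hM, heq, h⟩ := denote_unsatProg redClauses n seen (decide (rest.length = n * n))
    (inputArrays (Arr.base .adj) n rest) fun i j => by simp [inputArrays]
  rw [h v hv, decide_eq_true_iff]
  have hin : rest.length = n * n → ∀ i < n, ∀ j < n,
      inputArrays (Arr.base .adj) n rest (.base .adj) i j = rest.getD (i * n + j) false :=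
    fun hl i hi j hj => inputArrays_self _ hl hi hj
  constructor
  · rintro ⟨rfl, hl, hA, hsat⟩
    set A := inputArrays (Arr.base .adj) n rest (.base .adj) with hAdef
    let G : SimpleGraph (Fin n) :=
      ⟨fun i j => A i j = true, ⟨fun i j => (hA i i.2 j j.2).1⟩, ⟨fun i hi => by
        simp [(hA i i.2 i i.2).2] at hi⟩⟩
    refine ⟨n, G, (encodeGraph_eq_iff G rest).2 ⟨hl, fun i j => ?_⟩, ?_⟩
    · rw [← hin hl i i.2 j j.2]
    · by_contra hG
      rw [not_arrows_iff_exists_isRedGraph,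
        ← satisfiable_clauses_redClauses_iff G M (fun i j => by rw [hM]) heq] at hG
      exact hsat hG
  · rintro ⟨m, G, hG, harr⟩
    obtain ⟨rfl, rfl⟩ : seen = true ∧ m = n := by
      cases seen
      · have : false ∈ encodeGraph G := by simp [encodeGraph]
        rw [hG] at this
        simp at this
      · exact ⟨rfl, (replicate_append_cons_inj hG).1⟩
    obtain ⟨hl, hadj⟩ := (encodeGraph_eq_iff G rest).1 hG
    have hA : ∀ i j : Fin m,
        inputArrays (Arr.base .adj) m rest (.base .adj) i j = true ↔ G.Adj i j := fun i j => by
      rw [hin hl i i.2 j j.2, hadj]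
    refine ⟨rfl, hl, fun i hi j hj => ⟨fun h => ?_, ?_⟩, fun hsat => ?_⟩
    · exact (hA ⟨j, hj⟩ ⟨i, hi⟩).2 ((hA ⟨i, hi⟩ ⟨j, hj⟩).1 h).symm
    · rw [← Bool.not_eq_true]
      exact fun h => G.irrefl ((hA ⟨i, hi⟩ ⟨i, hi⟩).1 h)
    · rw [satisfiable_clauses_redClauses_iff G M (fun i j => by rw [hM, hA]) heq,
        ← not_arrows_iff_exists_isRedGraph] at hsat
      exact hsat harr

end PathArrowing

theorem mainTheorem5 :
    PathArrowing.InP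
      (PathArrowing.arrowingLanguage (SimpleGraph.pathGraph 3) (SimpleGraph.pathGraph 4)) := by
  exact PathArrowing.inP_arrowingLanguage_pathGraph_three_four
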